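/- Let $n,p\ge 1$, let $\mu\in\mathbb{R}^{n\times p}$ and $\sigma^2>0$ (both unknown), and let the data matrix $X\in\mathbb{R}^{n\times p}$ have independent rows $X_i\sim\mathcal N_p(\mu_i,\sigma^2 I_p)$. Let $\tau>0$ and let $d(M;X)$ be any dissimilarity (linkage) between two clusters $M=(C_1,C_2)$, i.e. a real-valued, symmetric function of the two clusters which is measurable in $X$. Randomized agglomerative clustering starts from the singletons $\{1\},\dots,\{n\}$ and performs $n-K$ merges ($1\le K\le n$): at step $s$, given $X$ and the earlier merges, it draws a pair $M^{(s)}$ from the set $\mathcal M^{(s)}$ of pairs of distinct current clusters, with $$\mathbb P\big(M^{(s)}=M\mid X,M^{(1)},\dots,M^{(s-1)}\big)=p^{(s)}(M;X):=\frac{\exp\{-d(M;X)/\tau^{(s)}\}}{\sum_{M'\in\mathcal M^{(s)}}\exp\{-d(M';X)/\tau^{(s)}\}},\qquad \tau^{(s)}=\frac{\tau}{|\mathcal M^{(s)}|}\sum_{M'\in\mathcal M^{(s)}}d(M';X)$$ (uniformly on $\mathcal M^{(s)}$ if $\tau^{(s)}=0$), and replaces the two chosen clusters by their union. Fix $1\le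 t\le n-K$ and a sequence of merges $m=(M_o^{(1)},\dots,M_o^{(t)})$ such that the event $E=\{M^{(s)}=M_o^{(s)},\ 1\le s\le t\}$ has positive probability. Write $M_o^{(t)}=(C_1,C_2)$ and $N=|C_1|+|C_2|$, and assume $N\ge 3$. Let $$R=(N-2)\,\frac{\frac{|C_1||C_2|}{N}\|\bar X_{C_1}-\bar X_{C_2}\|_2^2}{\sum_{i\in C_1}\|X_i-\bar X_{C_1}\|_2^2+\sum_{i\in C_2}\|X_i-\bar X_{C_2}\|_2^2},$$ where $\bar X_C$ is the mean of the rows of $X$ in $C$. Let $\nu=\frac{1_{C_1}}{|C_1|}-\frac{1_{C_2}}{|C_2|}$, $B=\nu\nu^\top/\|\nu\|_2^2$ and $W=\sum_{j=1,2}\big(I_{C_j}-1_{C_j}1_{C_j}^\top/|C_j|\big)$, where $1_C\in\mathbb{R}^n$ is the indicator vector of $C$ and $I_C=\mathrm{diag}(1_C)$, and let $$\mathcal A=(\eta,\gamma,\Delta,\Gamma)=\Big(\tfrac{BX}{\|BX\|_F},\ \tfrac{WX}{\|WX\|_F},\ \|BX\|_F^2+\|WX\|_F^2,\ (I_n-B-W)X\Big).$$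 Define the conditional p-value $\mathbf P^{(t)}=\mathbf P^{(t)}(R;\mathcal A)$ as the function $$\mathbf P^{(t)}(r;a)=\mathbb P\big(R\ge r\mid E,\ \mathcal A=a\big)$$ (given by a regular conditional distribution of $R$ given $\mathcal A$ under $\mathbb P(\cdot\mid E)$), evaluated at $(R,\mathcal A)$. Suppose that the null hypothesis $H_0^{(t)}$ holds: $\mu_i=\mu_{i'}$ for all $i,i'\in C_1\cup C_2$. Then: (i) $\mathbf P^{(t)}$ can be computed without knowing $\mu$ and $\sigma^2$: almost surely given $E$, $\mathbf P^{(t)}=1-\mathbb F^{(t)}(R;\mathcal A,m)$, where, for $a=(\eta,\gamma,\Delta,\Gamma)$, $$\mathbb F^{(t)}(r;a,m)=\frac{\int_0^r \ell(r')\prod_{s=1}^t p^{(s)}\big(M_o^{(s)};X(r';a)\big)\,dr'}{\int_0^\infty \ell(r')\prod_{s=1}^t p^{(s)}\big(M_o^{(s)};X(r';a)\big)\,dr'},\qquad X(r;a)=\sqrt{\Delta}\Big(\eta\sqrt{\tfrac{r}{N-2+r}}+\gamma\sqrt{\tfrac{N-2}{N-2+r}}\Big)+\Gamma,$$ $\ell$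 is the density of the $F_{p,(N-2)p}$ distribution, and $p^{(s)}(\cdot\,;x)$ is evaluated with the clusters that result from $M_o^{(1)},\dots,M_o^{(s-1)}$. (ii) The conditional Type I error is exact: $$\mathbb P\big(\mathbf P^{(t)}\le\alpha\ \big|\ M^{(1)}=M_o^{(1)},\dots,M^{(t)}=M_o^{(t)}\big)=\alpha\qquad\text{for all }0\le\alpha\le1.$$ -/

import Mathlib

open MeasureTheory ProbabilityTheory
open scoped ENNReal

noncomputable section

namespace RandClust

/-! ### Data, clusters, merges and the randomized agglomerative clustering algorithm -/

/-- An `n × p` data matrix, given by its `n` rows in `ℝ^p` (with the Euclidean norm). -/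
abbrev Data (n p : ℕ) := Fin n → EuclideanSpace ℝ (Fin p)

/-- A cluster is a set of observations. -/
abbrev Cluster (n : ℕ) := Finset (Fin n)

/-- A merge is an (unordered) pair of clusters `s(C₁, C₂)`. -/
abbrev Merge (n : ℕ) := Sym2 (Cluster n)

/-- The initial collection of clusters `{{1}, …, {n}}`. -/
def singletons (n : ℕ) : Finset (Cluster n) := Finset.univ.image fun i : Fin n => {i}

/-- The candidate merges: all pairs of distinct clusters of the collection `C`. -/
def candidates {n : ℕ} (C : Finset (Cluster n)) : Finset (Merge n) :=
  C.sym2.filter fun c => ¬ c.IsDiag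

/-- The collection `C \ {C₁, C₂} ∪ {C₁ ∪ C₂}` after the merge `c = s(C₁, C₂)`. -/
def update {n : ℕ} (C : Finset (Cluster n)) (c : Merge n) : Finset (Cluster n) :=
  insert c.sup (C.filter fun A => A ∉ c)

/-- The collection of clusters after the first `s` merges `m 0, …, m (s - 1)`. -/
def clusters {n : ℕ} (m : ℕ → Merge n) : ℕ → Finset (Cluster n)
  | 0 => singletons n
  | s + 1 => update (clusters m s) (m s)

/-- The amount of randomization: `τ` times the average dissimilarity over the candidate merges. -/
def temperature {n p : ℕ} (d : Merge n → Data n p → ℝ) (τ : ℝ) (x : Data n p)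
    (C : Finset (Cluster n)) : ℝ :=
  τ * ((1 / ((candidates C).card : ℝ)) * ∑ c ∈ candidates C, d c x)

/-- The probability with which the algorithm, run on the data `x`, selects the merge `c` when the
current collection of clusters is `C`: the softmax of `-d / temperature` over the candidates (and
`0` for a `c` that is not a candidate). If all candidate dissimilarities are zero, then `u / 0 = 0`
makes this the uniform distribution on the candidates. -/
def mergeProb {n p : ℕ} (d : Merge n → Data n p → ℝ) (τ : ℝ) (x : Data n p)
    (C : Finset (Cluster n)) (c : Merge n) : ℝ :=
  if c ∈ candidates C then
    Real.exp (-(d c x / temperature d τ x C)) /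
      ∑ c' ∈ candidates C, Real.exp (-(d c' x / temperature d τ x C))
  else 0

/-- The information available before merge number `s`: the data and the merges `M 0, …, M (s-1)`. -/
abbrev history {Ω : Type*} {n p : ℕ} (X : Ω → Data n p) (M : ℕ → Ω → Merge n) (s : ℕ) :
    MeasurableSpace Ω :=
  MeasurableSpace.comap X inferInstance ⊔
    ⨆ i : Fin s, MeasurableSpace.comap (M i) (⊤ : MeasurableSpace (Merge n))

/-- `M 0, M 1, …, M (n - K - 1)` are the successive random merges made by the randomized
agglomerative clustering algorithm with dissimilarity (linkage) `d`, randomization parameter `τ` and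
final number of clusters `K`, on the random data matrix `X`: given the data and the earlier merges,
each merge is drawn from the softmax probabilities `mergeProb` at the current clusters. -/
structure IsRandomizedClustering {Ω : Type*} [MeasurableSpace Ω] {n p : ℕ} (P : Measure Ω)
    (d : Merge n → Data n p → ℝ) (τ : ℝ) (K : ℕ) (X : Ω → Data n p) (M : ℕ → Ω → Merge n) :
    Prop where
  measurableSet_eq : ∀ s < n - K, ∀ c : Merge n, MeasurableSet {ω | M s ω = c}
  condProb_eq : ∀ s < n - K, ∀ c : Merge n,
    P⟦{ω | M s ω = c} | history X M s⟧ =ᵐ[P]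
      fun ω => mergeProb d τ (X ω) (clusters (fun i => M i ω) s) c

/-- The law of a data matrix with independent rows `X_i ∼ N_p(μ_i, σ² I_p)`, that is, the matrix
normal distribution `MN(μ, I_n, σ² I_p)`. -/
def gaussianData {n p : ℕ} (μ : Data n p) (σ : ℝ) : Measure (Data n p) :=
  Measure.pi fun i => multivariateGaussian (μ i) (σ ^ 2 • (1 : Matrix (Fin p) (Fin p) ℝ))

/-! ### Test statistic -/

/-- The mean `X̄_C` of the cluster `C`. -/
def clusterMean {n p : ℕ} (x : Data n p) (C : Cluster n) : EuclideanSpace ℝ (Fin p) :=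
  (C.card : ℝ)⁻¹ • ∑ i ∈ C, x i

/-- The number of observations in the two clusters. -/
def pairSize {n : ℕ} (C₁ C₂ : Cluster n) : ℝ := (C₁.card : ℝ) + (C₂.card : ℝ)

/-- Between-cluster sum of squares. -/
def bcss {n p : ℕ} (C₁ C₂ : Cluster n) (x : Data n p) : ℝ :=
  (C₁.card : ℝ) * (C₂.card : ℝ) / pairSize C₁ C₂ * ‖clusterMean x C₁ - clusterMean x C₂‖ ^ 2

/-- Within-cluster sum of squares. -/
def wcss {n p : ℕ} (C₁ C₂ : Cluster n) (x : Data n p) : ℝ :=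
  ∑ i ∈ C₁, ‖x i - clusterMean x C₁‖ ^ 2 + ∑ i ∈ C₂, ‖x i - clusterMean x C₂‖ ^ 2

/-- The test statistic `R = (N - 2) · BCSS / WCSS`. -/
def testStat {n p : ℕ} (C₁ C₂ : Cluster n) (x : Data n p) : ℝ :=
  (pairSize C₁ C₂ - 2) * (bcss C₁ C₂ x / wcss C₁ C₂ x)

/-! ### Auxiliary statistics -/

/-- The product `A x` of an `n × n` matrix and the data matrix `x`. -/
def matAct {n p : ℕ} (A : Matrix (Fin n) (Fin n) ℝ) (x : Data n p) : Data n p :=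
  fun i => ∑ k, A i k • x k

/-- The Frobenius norm of a data matrix. -/
def frob {n p : ℕ} (x : Data n p) : ℝ := Real.sqrt (∑ i, ‖x i‖ ^ 2)

/-- The direction `x / ‖x‖_F`. -/
def dir {n p : ℕ} (x : Data n p) : Data n p := (frob x)⁻¹ • x

/-- The indicator vector `1_C`. -/
def ind {n : ℕ} (C : Cluster n) : Fin n → ℝ := fun i => if i ∈ C then 1 else 0

/-- The contrast vector `ν`. -/
def nu {n : ℕ} (C₁ C₂ : Cluster n) : Fin n → ℝ :=
  fun i => ind C₁ i / (C₁.card : ℝ) - ind C₂ i / (C₂.card : ℝ)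

/-- The projection `B = ν νᵀ / ‖ν‖²`. -/
def matB {n : ℕ} (C₁ C₂ : Cluster n) : Matrix (Fin n) (Fin n) ℝ :=
  (∑ i, nu C₁ C₂ i ^ 2)⁻¹ • Matrix.vecMulVec (nu C₁ C₂) (nu C₁ C₂)

/-- The centering matrix `I_C - 1_C 1_Cᵀ / |C|` of a cluster. -/
def centering {n : ℕ} (C : Cluster n) : Matrix (Fin n) (Fin n) ℝ :=
  Matrix.diagonal (ind C) - (C.card : ℝ)⁻¹ • Matrix.vecMulVec (ind C) (ind C)

/-- The within-cluster projection `W`. -/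
def matW {n : ℕ} (C₁ C₂ : Cluster n) : Matrix (Fin n) (Fin n) ℝ := centering C₁ + centering C₂

/-- Values `(η, γ, Δ, Γ)` of the auxiliary statistics. -/
abbrev Aux (n p : ℕ) := Data n p × Data n p × ℝ × Data n p

/-- The auxiliary statistics
`(dir (B X), dir (W X), ‖B X‖_F² + ‖W X‖_F², (I - B - W) X)`. -/
def auxStat {n p : ℕ} (C₁ C₂ : Cluster n) (x : Data n p) : Aux n p :=
  (dir (matAct (matB C₁ C₂) x), dir (matAct (matW C₁ C₂) x),
    frob (matAct (matB C₁ C₂) x) ^ 2 + frob (matAct (matW C₁ C₂) x) ^ 2,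
    matAct (1 - matB C₁ C₂ - matW C₁ C₂) x)

/-- The data matrix `X(r; η, γ, Δ, Γ)` with test statistic `r` and the given auxiliary statistics. -/
def reconstruct {n p : ℕ} (C₁ C₂ : Cluster n) (r : ℝ) (a : Aux n p) : Data n p :=
  Real.sqrt a.2.2.1 •
      (Real.sqrt (r / (pairSize C₁ C₂ - 2 + r)) • a.1 +
        Real.sqrt ((pairSize C₁ C₂ - 2) / (pairSize C₁ C₂ - 2 + r)) • a.2.1) +
    a.2.2.2

/-! ### The conditional p-value -/

/-- The event `{M 0 = m 0, …, M (t - 1) = m (t - 1)}` that the first `t` merges are those of `m`. -/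
def mergeEvent {Ω : Type*} {n : ℕ} (M : ℕ → Ω → Merge n) (m : ℕ → Merge n) (t : ℕ) : Set Ω :=
  {ω | ∀ s < t, M s ω = m s}

/-- The conditional p-value, as a function of a value `r` of the test statistic and a value `a` of
the auxiliary statistics: the probability that the test statistic is at least `r`, under the
(regular) conditional distribution of the test statistic given the event `E` and given that the
auxiliary statistics equal `a`. -/
def condPValue {Ω : Type*} [MeasurableSpace Ω] {n p : ℕ} (P : Measure Ω) (X : Ω → Data n p)
    (E : Set Ω) (C₁ C₂ : Cluster n) (r : ℝ) (a : Aux n p) : ℝ :=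
  (condDistrib (fun ω => testStat C₁ C₂ (X ω)) (fun ω => auxStat C₁ C₂ (X ω)) (P[|E]) a).real
    (Set.Ici r)

/-- The density at `r > 0` of the `F` distribution with `d₁` and `d₂` degrees of freedom. -/
def fDensity (d₁ d₂ r : ℝ) : ℝ :=
  Real.Gamma ((d₁ + d₂) / 2) / (Real.Gamma (d₁ / 2) * Real.Gamma (d₂ / 2)) *
    (d₁ / d₂) ^ (d₁ / 2) * r ^ (d₁ / 2 - 1) * (1 + d₁ / d₂ * r) ^ (-((d₁ + d₂) / 2))

/-- The `F_{p, (N-2) p}` density at `r`, times the probability that the algorithm run on the data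
`X(r; a)` makes `m 0, …, m (t - 1)` as its first `t` merges. -/
def selDensity {n p : ℕ} (d : Merge n → Data n p → ℝ) (τ : ℝ) (m : ℕ → Merge n) (t : ℕ)
    (C₁ C₂ : Cluster n) (a : Aux n p) (r : ℝ) : ℝ :=
  fDensity p ((pairSize C₁ C₂ - 2) * p) r *
    ∏ s ∈ Finset.range t, mergeProb d τ (reconstruct C₁ C₂ r a) (clusters m s) (m s)

/-- The function `𝔽(r; a, m)`: a ratio of two one-dimensional integrals, which involves neither the
mean matrix nor the variance of the data. -/
def selCDF {n p : ℕ} (d : Merge n → Data n p → ℝ) (τ : ℝ) (m : ℕ → Merge n) (t : ℕ)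
    (C₁ C₂ : Cluster n) (r : ℝ) (a : Aux n p) : ℝ :=
  (∫ r' in Set.Ioc 0 r, selDensity d τ m t C₁ C₂ a r') /
    ∫ r' in Set.Ioi 0, selDensity d τ m t C₁ C₂ a r'

end RandClust

end

/-!
Under the null hypothesis the projections `B` and `W` annihilate the mean matrix, so `B X` and `W X`
are centered Gaussian vectors of dimensions `p` and `(N - 2) p`, independent of each other and of
`(I - B - W) X` (`stdGaussian_eq_map_add`). In polar coordinates the direction of a Gaussian vector
is independent of its norm, whose square has a `χ²` law (`exists_stdGaussian_eq_map_polar`), and the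
ratio of two independent `χ²` variables is independent of their sum (`prod_chiSq_eq_map`). Hence the
test statistic `R` is independent of the auxiliary statistics `A`, and its law is an `F` law
(`exists_map_gaussianData_eq_prod`). Normalizing constants are never computed: they cancel in the
ratio of integrals that defines the selective distribution function.

Given the data, the prescribed merges occur with probability `∏ₛ p⁽ˢ⁾`
(`IsRandomizedClustering.map_restrict_mergeEvent`), and the data are a function of `(R, A)`
(`reconstruct_testStat`). Conditioning on the merges therefore tilts the product law of `(A, R)` by
this probability, which is positive and at most one. The conditional law of `R` given `A` and the
merges has a density proportional to the `F` density times the tilt (`map_cond_eq_compProd`). This is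
the formula for the p-value, and since this law has no atoms, its survival function evaluated at `R`
is uniformly distributed (`measure_survival_le`); both are combined in `selective_pValue`.
-/

/-! ### Probability integral transform -/

namespace RandClust

open Set Filter Topology

theorem continuous_cdf (κ : Measure ℝ) [IsProbabilityMeasure κ] [NullSingletonClass κ] :
    Continuous (cdf κ) := by
  refine continuous_iff_continuousAt.2 fun x => ?_
  rw [(monotone_cdf κ).continuousAt_iff_leftLim_eq_rightLim, (cdf κ).rightLim_eq]
  have h : (cdf κ).measure {x} = 0 := by rw [measure_cdf]; exact measure_singleton x
  rw [StieltjesFunction.measure_singleton, ENNReal.ofReal_eq_zero, sub_nonpos] at h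
  exact le_antisymm ((monotone_cdf κ).leftLim_le le_rfl) h

theorem measureReal_Ici_eq (κ : Measure ℝ) [IsProbabilityMeasure κ] [NullSingletonClass κ]
    (r : ℝ) : κ.real (Ici r) = 1 - cdf κ r := by
  rw [cdf_eq_real, ← compl_Iio, probReal_compl_eq_one_sub measurableSet_Iio,
    measureReal_congr (Iio_ae_eq_Iic (μ := κ) (a := r))]

/-- The probability integral transform: under an atomless law, the survival function evaluated at
the observation is uniformly distributed. -/
theorem measure_survival_le (κ : Measure ℝ) [IsProbabilityMeasure κ] [NullSingletonClass κ]
    {α : ℝ} (h0 : 0 ≤ α) (h1 : α ≤ 1) :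
    κ {r | κ.real (Ici r) ≤ α} = ENNReal.ofReal α := by
  have hset : {r | κ.real (Ici r) ≤ α} = {r | 1 - α ≤ cdf κ r} := by
    ext r
    simp only [mem_ofPred_eq, measureReal_Ici_eq]
    constructor <;> intro h <;> linarith
  have hclosed : IsClosed {r | 1 - α ≤ cdf κ r} := isClosed_le continuous_const (continuous_cdf κ)
  rw [hset]
  apply le_antisymm
  · rcases eq_empty_or_nonempty {r | 1 - α ≤ cdf κ r} with he | hne
    · rw [he]; simp
    by_cases hb : BddBelow {r | 1 - α ≤ cdf κ r}
    · have hmem := hclosed.csInf_mem hne hb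
      have hsub : {r | 1 - α ≤ cdf κ r} ⊆ Ici (sInf {r | 1 - α ≤ cdf κ r}) :=
        fun r hr => csInf_le hb hr
      refine (measure_mono hsub).trans ?_
      rw [← ofReal_measureReal, measureReal_Ici_eq]
      refine ENNReal.ofReal_le_ofReal ?_
      have : 1 - α ≤ cdf κ (sInf {r | 1 - α ≤ cdf κ r}) := hmem
      linarith
    -- If the set is unbounded below it is the whole line, which forces `α = 1`.
    · have hall : ∀ r, 1 - α ≤ cdf κ r := by
        intro r
        rw [not_bddBelow_iff] at hb
        obtain ⟨y, hy, hyr⟩ := hb r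
        exact le_trans hy (monotone_cdf κ hyr.le)
      have : 1 - α ≤ 0 := ge_of_tendsto' (tendsto_cdf_atBot κ) hall
      have : α = 1 := by linarith
      subst this
      simpa using prob_le_one
  · rcases h0.eq_or_lt with rfl | h0
    · simp
    rcases h1.eq_or_lt with rfl | h1
    · have : {r | 1 - 1 ≤ cdf κ r} = univ := by
        ext r; simp [cdf_nonneg]
      rw [this]; simp
    obtain ⟨r, hr⟩ : ∃ r, cdf κ r = 1 - α := by
      obtain ⟨a, ha⟩ := ((tendsto_cdf_atBot κ).eventually_lt_const
        (show (0 : ℝ) < 1 - α by linarith)).exists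
      obtain ⟨b, hb⟩ := ((tendsto_cdf_atTop κ).eventually_const_lt
        (show 1 - α < (1 : ℝ) by linarith)).exists
      exact mem_range_of_exists_le_of_exists_ge (continuous_cdf κ) ⟨a, ha.le⟩ ⟨b, hb.le⟩
    have hsub : Ici r ⊆ {r | 1 - α ≤ cdf κ r} := fun s hs => by
      have := monotone_cdf κ (show r ≤ s from hs)
      simp only [mem_ofPred_eq]; linarith
    refine le_trans ?_ (measure_mono hsub)
    rw [← ofReal_measureReal, measureReal_Ici_eq, hr]
    simp

section Tilting

variable {Ω 𝒜 : Type*} [MeasurableSpace Ω] [MeasurableSpace 𝒜]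

/-- The probability kernel obtained by tilting the measure `l` on `ℝ` by the density `w a`,
normalized for each value of the parameter `a`. -/
noncomputable def tilted (l : Measure ℝ) [SFinite l] (w : 𝒜 → ℝ → ℝ≥0∞) : Kernel 𝒜 ℝ :=
  Kernel.withDensity (Kernel.const 𝒜 l) fun a r => w a r / ∫⁻ r, w a r ∂l

variable {l : Measure ℝ} [SFinite l] {w : 𝒜 → ℝ → ℝ≥0∞}

theorem measurable_normalized (hw : Measurable (Function.uncurry w)) :
    Measurable (Function.uncurry fun a r => w a r / ∫⁻ r, w a r ∂l) :=
  hw.div (hw.lintegral_prod_right.comp measurable_fst)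

theorem tilted_apply (hw : Measurable (Function.uncurry w)) (a : 𝒜) (s : Set ℝ) :
    tilted l w a s = (∫⁻ r in s, w a r ∂l) / ∫⁻ r, w a r ∂l := by
  have hwa : Measurable (w a) := hw.of_uncurry_left
  rw [tilted, Kernel.withDensity_apply' _ (measurable_normalized hw), Kernel.const_apply]
  simp_rw [div_eq_mul_inv]
  rw [lintegral_mul_const _ hwa]

theorem isMarkovKernel_tilted (hw : Measurable (Function.uncurry w))
    (h0 : ∀ a, ∫⁻ r, w a r ∂l ≠ 0) (h1 : ∀ a, ∫⁻ r, w a r ∂l ≠ ∞) :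
    IsMarkovKernel (tilted l w) :=
  ⟨fun a => ⟨by rw [tilted_apply hw, setLIntegral_univ, ENNReal.div_self (h0 a) (h1 a)]⟩⟩

theorem nullSingletonClass_tilted [NullSingletonClass l] (hw : Measurable (Function.uncurry w))
    (a : 𝒜) : NullSingletonClass (tilted l w a) :=
  ⟨fun x => by rw [tilted_apply hw, Measure.restrict_singleton]; simp⟩

/-- If `(A, R)` has a product law and an event has conditional probability `w A R` given `(A, R)`,
then conditionally on this event and on `A` the law of `R` is the tilted one. -/
theorem map_cond_eq_compProd {P : Measure Ω} [IsProbabilityMeasure P] {E : Set Ω}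
    (hE : MeasurableSet E) {R : Ω → ℝ} {A : Ω → 𝒜} (hR : Measurable R)
    (hA : Measurable A) {Q : Measure 𝒜} [SFinite Q]
    (hlaw : P.map (fun ω => (A ω, R ω)) = Q.prod l) (hw : Measurable (Function.uncurry w))
    (h0 : ∀ a, ∫⁻ r, w a r ∂l ≠ 0) (h1 : ∀ a, ∫⁻ r, w a r ∂l ≠ ∞)
    (hsel : ∀ S : Set (𝒜 × ℝ), MeasurableSet S →
      P (E ∩ (fun ω => (A ω, R ω)) ⁻¹' S) =
        ∫⁻ ω in (fun ω => (A ω, R ω)) ⁻¹' S, w (A ω) (R ω) ∂P) :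
    (P[|E]).map (fun ω => (A ω, R ω)) = (P[|E]).map A ⊗ₘ tilted l w := by
  have := isMarkovKernel_tilted hw h0 h1
  have hAR : Measurable fun ω => (A ω, R ω) := hA.prodMk hR
  have hZ : Measurable fun a => ∫⁻ r, w a r ∂l := hw.lintegral_prod_right
  have key : (P[|E]).map (fun ω => (A ω, R ω)) =
      (P E)⁻¹ • (Q.prod l).withDensity (Function.uncurry w) := by
    ext S hS
    rw [Measure.map_apply hAR hS, cond_apply hE, hsel S hS, Measure.smul_apply,
      withDensity_apply _ hS, ← hlaw, setLIntegral_map hS hw hAR]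
    rfl
  have keyA : (P[|E]).map A = (P E)⁻¹ • Q.withDensity fun a => ∫⁻ r, w a r ∂l := by
    have : (P[|E]).map A = ((P[|E]).map fun ω => (A ω, R ω)).map Prod.fst := by
      rw [Measure.map_map measurable_fst hAR]; rfl
    rw [this, key]
    ext S hS
    rw [Measure.map_apply measurable_fst hS, Measure.smul_apply, Measure.smul_apply,
      withDensity_apply _ (measurable_fst hS), withDensity_apply _ hS, ← prod_univ,
      setLIntegral_prod _ hw.aemeasurable]
    simp
  rw [key]
  ext S hS
  rw [Measure.compProd_apply hS, keyA, Measure.smul_apply, lintegral_smul_measure,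
    lintegral_withDensity_eq_lintegral_mul _ hZ (Kernel.measurable_kernel_prodMk_left hS),
    withDensity_apply _ hS, ← lintegral_indicator hS,
    lintegral_prod _ (hw.indicator hS).aemeasurable]
  congr 1
  refine lintegral_congr fun a => ?_
  rw [Pi.mul_apply, tilted_apply hw, ENNReal.mul_div_cancel (h0 a) (h1 a),
    ← lintegral_indicator (measurable_prodMk_left hS)]
  rfl

end Tilting

end RandClust

/-! ### The conditional p-value in an abstract selection model -/

namespace RandClust

open Set Filter Topology

section Selection

variable {Ω 𝒜 : Type*} [MeasurableSpace Ω] [MeasurableSpace 𝒜]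

/-- The measure on `(0, ∞)` with density `f`. -/
noncomputable def halfLineMeasure (f : ℝ → ℝ) : Measure ℝ :=
  (volume.restrict (Ioi 0)).withDensity fun r => ENNReal.ofReal (f r)

theorem setLIntegral_halfLineMeasure {f g : ℝ → ℝ} (hf : Measurable f) (hg : Measurable g)
    (hf0 : ∀ r ∈ Ioi (0 : ℝ), 0 ≤ f r) {s : Set ℝ} (hs : MeasurableSet s) :
    ∫⁻ r in s, ENNReal.ofReal (g r) ∂(halfLineMeasure f) =
      ∫⁻ r in s ∩ Ioi 0, ENNReal.ofReal (f r * g r) := by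
  rw [halfLineMeasure, setLIntegral_withDensity_eq_setLIntegral_mul _ hf.ennreal_ofReal
    hg.ennreal_ofReal hs, Measure.restrict_restrict hs]
  refine setLIntegral_congr_fun (hs.inter measurableSet_Ioi) fun r hr => ?_
  exact (ENNReal.ofReal_mul (hf0 r hr.2)).symm

/-- If, under `P`, the pair `(A, R)` has a product law whose second factor has density `f` on the
positive half-line, and the event `E` has conditional probability `w A R` given `(A, R)`, then the
conditional survival function of `R` given `E` and `A`, evaluated at `(R, A)`, is one minus a ratio
of integrals of `f * w A`, and it is uniformly distributed given `E`. -/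
theorem selective_pValue {P : Measure Ω} [IsProbabilityMeasure P] {E : Set Ω}
    (hE : MeasurableSet E) (hPE : P E ≠ 0) {R : Ω → ℝ} {A : Ω → 𝒜} (hR : Measurable R)
    (hA : Measurable A) {Q : Measure 𝒜} [SFinite Q] {f : ℝ → ℝ} (hf : Measurable f)
    (hf0 : ∀ r ∈ Ioi (0 : ℝ), 0 ≤ f r)
    (hlaw : P.map (fun ω => (A ω, R ω)) = Q.prod (halfLineMeasure f))
    {w : 𝒜 → ℝ → ℝ} (hw : Measurable (Function.uncurry w)) (hw0 : ∀ a r, 0 < w a r)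
    (hw1 : ∀ a r, w a r ≤ 1)
    (hsel : ∀ S : Set (𝒜 × ℝ), MeasurableSet S →
      P (E ∩ (fun ω => (A ω, R ω)) ⁻¹' S) =
        ∫⁻ ω in (fun ω => (A ω, R ω)) ⁻¹' S, ENNReal.ofReal (w (A ω) (R ω)) ∂P) :
    (∀ᵐ ω ∂(P[|E]), (condDistrib R A (P[|E]) (A ω)).real (Ici (R ω)) =
      1 - (∫ r in Ioc 0 (R ω), f r * w (A ω) r) / ∫ r in Ioi 0, f r * w (A ω) r) ∧
    ∀ α : ℝ, 0 ≤ α → α ≤ 1 →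
      P[|E] {ω | (condDistrib R A (P[|E]) (A ω)).real (Ici (R ω)) ≤ α} = ENNReal.ofReal α := by
  have : IsProbabilityMeasure (P[|E]) := cond_isProbabilityMeasure hPE
  have hAR : Measurable fun ω => (A ω, R ω) := hA.prodMk hR
  set l := halfLineMeasure f with hl
  have : SFinite l := by rw [hl, halfLineMeasure]; infer_instance
  have : NullSingletonClass l := by
    refine ⟨fun x => ?_⟩
    rw [hl, halfLineMeasure]
    exact withDensity_absolutelyContinuous _ _ (measure_singleton x)
  -- The total masses of the two factors multiply to one, so both are positive and finite.
  have hmass : Q univ * l univ = 1 := by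
    rw [← Measure.prod_prod, ← hlaw, univ_prod_univ,
      Measure.map_apply hAR MeasurableSet.univ, preimage_univ, measure_univ]
  have hl0 : l ≠ 0 := by
    rintro h
    simp [h] at hmass
  have hlfin : l univ ≠ ∞ := by
    intro h
    rw [h] at hmass
    rcases eq_or_ne (Q univ) 0 with hq | hq
    · simp [hq] at hmass
    · simp [ENNReal.mul_top hq] at hmass
  set w' : 𝒜 → ℝ → ℝ≥0∞ := fun a r => ENNReal.ofReal (w a r) with hw'
  have hwm : Measurable (Function.uncurry w') := hw.ennreal_ofReal
  have hwa : ∀ a, Measurable (w a) := fun a => hw.of_uncurry_left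
  have h0 : ∀ a, ∫⁻ r, w' a r ∂l ≠ 0 := by
    intro a h
    rw [lintegral_eq_zero_iff (hwa a).ennreal_ofReal] at h
    have : ∀ᵐ r ∂l, False := by
      filter_upwards [h] with r hr
      have := ENNReal.ofReal_pos.2 (hw0 a r)
      exact this.ne' hr
    rw [eventually_false_iff_eq_bot, ae_eq_bot] at this
    exact hl0 this
  have h1 : ∀ a, ∫⁻ r, w' a r ∂l ≠ ∞ := by
    intro a
    refine ne_top_of_le_ne_top hlfin ?_
    calc ∫⁻ r, w' a r ∂l ≤ ∫⁻ _, 1 ∂l :=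
          lintegral_mono fun r => ENNReal.ofReal_le_one.2 (hw1 a r)
      _ = l univ := by simp
  have hmark := isMarkovKernel_tilted hwm h0 h1
  have hjoint := map_cond_eq_compProd hE hR hA hlaw hwm h0 h1 hsel
  have hcd : ∀ᵐ a ∂((P[|E]).map A), condDistrib R A (P[|E]) a = tilted l w' a :=
    condDistrib_ae_eq_of_measure_eq_compProd A hR.aemeasurable hjoint
  have hcd' : ∀ᵐ ω ∂(P[|E]), condDistrib R A (P[|E]) (A ω) = tilted l w' (A ω) :=
    ae_of_ae_map hA.aemeasurable hcd
  have hnull := nullSingletonClass_tilted (l := l) hwm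
  have hint : ∀ a, ∀ s : Set ℝ, MeasurableSet s → ∫⁻ r in s, w' a r ∂l =
      ENNReal.ofReal (∫ r in s ∩ Ioi 0, f r * w a r) := by
    intro a s hs
    have hlt : ∫⁻ r in s ∩ Ioi 0, ENNReal.ofReal (f r * w a r) ≠ ∞ := by
      rw [← setLIntegral_halfLineMeasure hf (hwa a) hf0 hs]
      exact ne_top_of_le_ne_top (h1 a) (setLIntegral_le_lintegral _ _)
    have hnn : 0 ≤ᵐ[volume.restrict (s ∩ Ioi 0)] fun r => f r * w a r := by
      filter_upwards [ae_restrict_mem (hs.inter measurableSet_Ioi)] with r hr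
      exact mul_nonneg (hf0 r hr.2) (hw0 a r).le
    have hi : IntegrableOn (fun r => f r * w a r) (s ∩ Ioi 0) :=
      (lintegral_ofReal_ne_top_iff_integrable
        (hf.mul (hwa a)).aestronglyMeasurable hnn).1 hlt
    rw [setLIntegral_halfLineMeasure hf (hwa a) hf0 hs,
      ofReal_integral_eq_lintegral_ofReal hi hnn]
  have hsurv : ∀ a r, (tilted l w' a).real (Ici r) =
      1 - (∫ x in Ioc 0 r, f x * w a x) / ∫ x in Ioi 0, f x * w a x := by
    intro a r
    have hpos : ∀ s : Set ℝ, MeasurableSet s → 0 ≤ ∫ x in s ∩ Ioi 0, f x * w a x :=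
      fun s hs => setIntegral_nonneg (hs.inter measurableSet_Ioi)
        fun x hx => mul_nonneg (hf0 x hx.2) (hw0 a x).le
    have e : Iic r ∩ Ioi 0 = Ioc 0 r := by ext x; simp [and_comm]
    rw [measureReal_Ici_eq, cdf_eq_real, measureReal_def, tilted_apply hwm, ENNReal.toReal_div,
      hint a _ measurableSet_Iic, ← setLIntegral_univ, hint a _ MeasurableSet.univ,
      ENNReal.toReal_ofReal (hpos _ measurableSet_Iic),
      ENNReal.toReal_ofReal (hpos _ MeasurableSet.univ), univ_inter, e]
  refine ⟨?_, fun α hα0 hα1 => ?_⟩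
  · filter_upwards [hcd'] with ω hω
    rw [hω, hsurv]
  · have hmeas : Measurable fun z : 𝒜 × ℝ => (tilted l w' z.1).real (Ici z.2) := by
      have hT : MeasurableSet {z : (𝒜 × ℝ) × ℝ | z.1.2 ≤ z.2} :=
        measurableSet_le (measurable_snd.comp measurable_fst) measurable_snd
      have := Kernel.measurable_kernel_prodMk_left
        (κ := (tilted l w').comap (Prod.fst : 𝒜 × ℝ → 𝒜) measurable_fst) hT
      exact this.ennreal_toReal
    have hS : MeasurableSet {z : 𝒜 × ℝ | (tilted l w' z.1).real (Ici z.2) ≤ α} :=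
      measurableSet_le hmeas measurable_const
    have hae : {ω | (condDistrib R A (P[|E]) (A ω)).real (Ici (R ω)) ≤ α} =ᵐ[P[|E]]
        (fun ω => (A ω, R ω)) ⁻¹' {z : 𝒜 × ℝ | (tilted l w' z.1).real (Ici z.2) ≤ α} := by
      filter_upwards [hcd'] with ω hω
      simp only [eq_iff_iff]
      change (condDistrib R A (P[|E]) (A ω)).real (Ici (R ω)) ≤ α ↔ _
      rw [hω]; rfl
    have : IsProbabilityMeasure ((P[|E]).map A) := Measure.isProbabilityMeasure_map hA.aemeasurable
    rw [measure_congr hae, ← Measure.map_apply hAR hS, hjoint, Measure.compProd_apply hS]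
    have : ∀ a, tilted l w' a (Prod.mk a ⁻¹' {z | (tilted l w' z.1).real (Ici z.2) ≤ α}) =
        ENNReal.ofReal α := fun a => measure_survival_le (tilted l w' a) hα0 hα1
    rw [lintegral_congr this, lintegral_const, measure_univ, mul_one]

end Selection

end RandClust

/-! ### Probability of a sequence of merges -/

namespace RandClust

section Algorithm

variable {n p : ℕ}

theorem mergeProb_nonneg (d : Merge n → Data n p → ℝ) (τ : ℝ) (x : Data n p)
    (C : Finset (Cluster n)) (c : Merge n) : 0 ≤ mergeProb d τ x C c := by
  unfold mergeProb
  split_ifs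
  · exact div_nonneg (Real.exp_pos _).le (Finset.sum_nonneg fun _ _ => (Real.exp_pos _).le)
  · exact le_rfl

theorem mergeProb_pos (d : Merge n → Data n p → ℝ) (τ : ℝ) (x : Data n p)
    {C : Finset (Cluster n)} {c : Merge n} (h : c ∈ candidates C) : 0 < mergeProb d τ x C c := by
  rw [mergeProb, if_pos h]
  exact div_pos (Real.exp_pos _) (Finset.sum_pos (fun _ _ => Real.exp_pos _) ⟨c, h⟩)

theorem mergeProb_le_one (d : Merge n → Data n p → ℝ) (τ : ℝ) (x : Data n p)
    (C : Finset (Cluster n)) (c : Merge n) : mergeProb d τ x C c ≤ 1 := by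
  unfold mergeProb
  split_ifs with h
  · refine div_le_one_of_le₀ ?_ (Finset.sum_nonneg fun _ _ => (Real.exp_pos _).le)
    exact Finset.single_le_sum
      (f := fun c' => Real.exp (-(d c' x / temperature d τ x C)))
      (fun _ _ => (Real.exp_pos _).le) h
  · exact zero_le_one

theorem measurable_mergeProb {d : Merge n → Data n p → ℝ} (hd : ∀ c, Measurable (d c)) (τ : ℝ)
    (C : Finset (Cluster n)) (c : Merge n) : Measurable fun x => mergeProb d τ x C c := by
  have ht : Measurable fun x => temperature d τ x C :=
    ((Finset.measurable_sum _ fun c _ => hd c).const_mul _).const_mul _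
  have he : ∀ c, Measurable fun x => Real.exp (-(d c x / temperature d τ x C)) :=
    fun c => ((hd c).div ht).neg.exp
  unfold mergeProb
  split_ifs
  · exact (he c).div (Finset.measurable_sum _ fun c _ => he c)
  · exact measurable_const

/-- The probability that the algorithm run on the data `x` makes `m 0, …, m (t - 1)` as its first
`t` merges. -/
noncomputable def pathProb (d : Merge n → Data n p → ℝ) (τ : ℝ) (m : ℕ → Merge n) (t : ℕ)
    (x : Data n p) : ℝ :=
  ∏ s ∈ Finset.range t, mergeProb d τ x (clusters m s) (m s)

theorem measurable_pathProb {d : Merge n → Data n p → ℝ} (hd : ∀ c, Measurable (d c)) (τ : ℝ)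
    (m : ℕ → Merge n) (t : ℕ) : Measurable (pathProb d τ m t) :=
  Finset.measurable_prod _ fun _ _ => measurable_mergeProb hd τ _ _

theorem pathProb_pos {d : Merge n → Data n p → ℝ} {τ : ℝ} {m : ℕ → Merge n} {t : ℕ}
    (h : ∀ s < t, m s ∈ candidates (clusters m s)) (x : Data n p) : 0 < pathProb d τ m t x :=
  Finset.prod_pos fun s hs => mergeProb_pos d τ x (h s (Finset.mem_range.1 hs))

theorem pathProb_le_one (d : Merge n → Data n p → ℝ) (τ : ℝ) (m : ℕ → Merge n) (t : ℕ)
    (x : Data n p) : pathProb d τ m t x ≤ 1 :=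
  Finset.prod_le_one (fun _ _ => mergeProb_nonneg ..) fun _ _ => mergeProb_le_one ..

theorem clusters_congr {m m' : ℕ → Merge n} {t : ℕ} (h : ∀ s < t, m s = m' s) :
    clusters m t = clusters m' t := by
  induction t with
  | zero => rfl
  | succ t ih =>
    rw [clusters, clusters, ih fun s hs => h s (hs.trans t.lt_succ_self), h t t.lt_succ_self]

variable {Ω : Type*}

theorem mergeEvent_succ (M : ℕ → Ω → Merge n) (m : ℕ → Merge n) (t : ℕ) :
    mergeEvent M m (t + 1) = mergeEvent M m t ∩ {ω | M t ω = m t} := by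
  ext ω
  simp only [mergeEvent, Set.mem_ofPred_eq, Set.mem_inter_iff, Nat.forall_lt_succ_right]

theorem measurableSet_history_mergeEvent (X : Ω → Data n p) (M : ℕ → Ω → Merge n)
    (m : ℕ → Merge n) (t : ℕ) : MeasurableSet[history X M t] (mergeEvent M m t) := by
  have : mergeEvent M m t = ⋂ i : Fin t, M i ⁻¹' {m i} := by
    ext ω
    simp only [mergeEvent, Set.mem_ofPred_eq, Set.mem_iInter, Set.mem_preimage,
      Set.mem_singleton_iff]
    exact ⟨fun h i => h i i.2, fun h s hs => h ⟨s, hs⟩⟩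
  rw [this]
  refine MeasurableSet.iInter fun i => ?_
  have h1 : MeasurableSet[MeasurableSpace.comap (M i) (⊤ : MeasurableSpace (Merge n))]
      (M i ⁻¹' {m i}) := ⟨{m i}, MeasurableSpace.measurableSet_top, rfl⟩
  exact (le_sup_of_le_right
    (le_iSup (fun i : Fin t => MeasurableSpace.comap (M i) (⊤ : MeasurableSpace (Merge n))) i)) _ h1

variable [MeasurableSpace Ω] {P : Measure Ω} {d : Merge n → Data n p → ℝ} {τ : ℝ}
  {K : ℕ} {X : Ω → Data n p} {M : ℕ → Ω → Merge n}

theorem IsRandomizedClustering.history_le (hM : IsRandomizedClustering P d τ K X M)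
    (hX : Measurable X) {t : ℕ} (ht : t ≤ n - K) : history X M t ≤ ‹MeasurableSpace Ω› := by
  refine sup_le hX.comap_le (iSup_le fun i => ?_)
  rintro _ ⟨S, -, rfl⟩
  have : M i ⁻¹' S = ⋃ c ∈ S, {ω | M i ω = c} := by
    ext ω; simp
  rw [this]
  exact MeasurableSet.biUnion S.to_countable
    fun c _ => hM.measurableSet_eq i (i.2.trans_le ht) c

theorem IsRandomizedClustering.measurableSet_mergeEvent (hM : IsRandomizedClustering P d τ K X M)
    (hX : Measurable X) (m : ℕ → Merge n) {t : ℕ} (ht : t ≤ n - K) :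
    MeasurableSet (mergeEvent M m t) :=
  hM.history_le hX ht _ (measurableSet_history_mergeEvent X M m t)

/-- Given the data, the first `t` merges are those of `m` with probability `pathProb`. -/
theorem IsRandomizedClustering.map_restrict_mergeEvent [IsProbabilityMeasure P]
    (hM : IsRandomizedClustering P d τ K X M)
    (hX : Measurable X) (hd : ∀ c, Measurable (d c)) (m : ℕ → Merge n) {t : ℕ} (ht : t ≤ n - K) :
    (P.restrict (mergeEvent M m t)).map X =
      (P.map X).withDensity fun x => ENNReal.ofReal (pathProb d τ m t x) := by
  induction t with
  | zero =>
    have : mergeEvent M m 0 = Set.univ := by ext; simp [mergeEvent]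
    simp [this, pathProb]
  | succ t ih =>
    have htn : t < n - K := ht
    have hE := hM.measurableSet_mergeEvent hX m htn.le
    have hq : Measurable fun x => mergeProb d τ x (clusters m t) (m t) :=
      measurable_mergeProb hd τ _ _
    have hpath := measurable_pathProb hd τ m t
    have hMt := hM.measurableSet_eq t htn (m t)
    ext S hS
    have hXS := hX hS
    -- The event that the data lie in `S` and the first `t` merges are prescribed is known
    -- before the next merge.
    have hB : MeasurableSet[history X M t] (mergeEvent M m t ∩ X ⁻¹' S) :=
      (measurableSet_history_mergeEvent X M m t).inter
        ((le_sup_left : MeasurableSpace.comap X inferInstance ≤ history X M t) _ ⟨S, hS, rfl⟩)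
    have hle := hM.history_le hX htn.le
    have hB' : MeasurableSet (mergeEvent M m t ∩ X ⁻¹' S) := hle _ hB
    have h1 : P.real (mergeEvent M m t ∩ X ⁻¹' S ∩ {ω | M t ω = m t}) =
        ∫ ω in mergeEvent M m t ∩ X ⁻¹' S, mergeProb d τ (X ω) (clusters m t) (m t) ∂P := by
      have e := setIntegral_condExp hle (μ := P)
        (f := ({ω | M t ω = m t}).indicator fun _ => (1 : ℝ))
        ((integrable_const 1).indicator hMt) hB
      rw [setIntegral_indicator hMt, setIntegral_const, smul_eq_mul, mul_one] at e
      rw [← e]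
      refine setIntegral_congr_ae hB' ?_
      filter_upwards [hM.condProb_eq t htn (m t)] with ω hω hωB
      rw [hω]
      congr 1
      exact clusters_congr fun s hs => hωB.1 s hs
    have h2 : P (mergeEvent M m t ∩ X ⁻¹' S ∩ {ω | M t ω = m t}) =
        ∫⁻ ω in mergeEvent M m t ∩ X ⁻¹' S,
          ENNReal.ofReal (mergeProb d τ (X ω) (clusters m t) (m t)) ∂P := by
      rw [← ofReal_measureReal, h1, ofReal_integral_eq_lintegral_ofReal]
      · refine Integrable.of_bound (hq.comp hX).aestronglyMeasurable 1 (ae_of_all _ fun ω => ?_)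
        rw [Real.norm_of_nonneg (mergeProb_nonneg ..)]
        exact mergeProb_le_one ..
      · exact ae_of_all _ fun ω => mergeProb_nonneg ..
    have h3 : ∀ x, ENNReal.ofReal (pathProb d τ m (t + 1) x) =
        ENNReal.ofReal (pathProb d τ m t x) *
          ENNReal.ofReal (mergeProb d τ x (clusters m t) (m t)) := by
      intro x
      rw [pathProb, Finset.prod_range_succ, ENNReal.ofReal_mul
        (Finset.prod_nonneg fun _ _ => mergeProb_nonneg ..)]
      rfl
    rw [Measure.map_apply hX hS, Measure.restrict_apply hXS, mergeEvent_succ,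
      show X ⁻¹' S ∩ (mergeEvent M m t ∩ {ω | M t ω = m t}) =
        mergeEvent M m t ∩ X ⁻¹' S ∩ {ω | M t ω = m t} by
        rw [← Set.inter_assoc, Set.inter_comm (X ⁻¹' S)], h2,
      Set.inter_comm, ← Measure.restrict_restrict hXS,
      ← setLIntegral_map (μ := P.restrict (mergeEvent M m t))
        (f := fun x => ENNReal.ofReal (mergeProb d τ x (clusters m t) (m t)))
        hS hq.ennreal_ofReal hX, ih htn.le,
      setLIntegral_withDensity_eq_setLIntegral_mul _ hpath.ennreal_ofReal hq.ennreal_ofReal hS,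
      withDensity_apply _ hS]
    simp only [h3, Pi.mul_apply]

/-- A sequence of merges that occurs with positive probability merges current clusters only. -/
theorem IsRandomizedClustering.mem_candidates [IsProbabilityMeasure P]
    (hM : IsRandomizedClustering P d τ K X M)
    (hX : Measurable X) (hd : ∀ c, Measurable (d c)) {m : ℕ → Merge n} {t : ℕ} (ht : t ≤ n - K)
    (hpos : P (mergeEvent M m t) ≠ 0) : ∀ s < t, m s ∈ candidates (clusters m s) := by
  intro s hs
  by_contra hc
  apply hpos
  have h : ∀ x, pathProb d τ m t x = 0 := fun x =>
    Finset.prod_eq_zero (Finset.mem_range.2 hs) (if_neg hc)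
  have e := congrArg (fun ν => ν Set.univ) (hM.map_restrict_mergeEvent hX hd m ht)
  simpa [h, Measure.map_apply hX MeasurableSet.univ] using e

theorem sup_mk (A B : Cluster n) : (s(A, B) : Merge n).sup = A ∪ B := rfl

/-- The clusters stay nonempty and pairwise disjoint as long as current clusters are merged. -/
theorem clusters_partition {m : ℕ → Merge n} {t : ℕ}
    (h : ∀ s < t, m s ∈ candidates (clusters m s)) :
    (∀ A ∈ clusters m t, A.Nonempty) ∧
      ∀ A ∈ clusters m t, ∀ B ∈ clusters m t, A ≠ B → Disjoint A B := by
  induction t with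
  | zero =>
    constructor
    · intro A hA
      obtain ⟨i, -, rfl⟩ := Finset.mem_image.1 hA
      exact Finset.singleton_nonempty i
    · intro A hA B hB hAB
      obtain ⟨i, -, rfl⟩ := Finset.mem_image.1 hA
      obtain ⟨j, -, rfl⟩ := Finset.mem_image.1 hB
      exact Finset.disjoint_singleton.2 fun hij => hAB (by rw [hij])
  | succ t ih =>
    obtain ⟨hne, hdisj⟩ := ih fun s hs => h s (hs.trans t.lt_succ_self)
    have hc := h t t.lt_succ_self
    rw [clusters]
    generalize m t = c at hc
    induction c using Sym2.ind with
    | _ C D =>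
    obtain ⟨hCD, -⟩ := Finset.mem_filter.1 hc
    obtain ⟨hC, hD⟩ := Finset.mk_mem_sym2_iff.1 hCD
    have hnew : ∀ B ∈ (clusters m t).filter (fun A => A ∉ (s(C, D) : Merge n)),
        B ∈ clusters m t ∧ Disjoint (C ∪ D) B := by
      intro B hB
      obtain ⟨hB, hB'⟩ := Finset.mem_filter.1 hB
      rw [Sym2.mem_iff, not_or] at hB'
      exact ⟨hB, Finset.disjoint_union_left.2
        ⟨hdisj C hC B hB (Ne.symm hB'.1), hdisj D hD B hB (Ne.symm hB'.2)⟩⟩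
    rw [update, sup_mk]
    constructor
    · intro A hA
      rcases Finset.mem_insert.1 hA with rfl | hA
      · exact (hne C hC).mono Finset.subset_union_left
      · exact hne A (hnew A hA).1
    · intro A hA B hB hAB
      rcases Finset.mem_insert.1 hA with rfl | hA <;> rcases Finset.mem_insert.1 hB with rfl | hB
      · exact absurd rfl hAB
      · exact (hnew B hB).2
      · exact (hnew A hA).2.symm
      · exact hdisj A (hnew A hA).1 B (hnew B hB).1 hAB

theorem nonempty_disjoint_of_mem_candidates {m : ℕ → Merge n} {t : ℕ}
    (h : ∀ s < t, m s ∈ candidates (clusters m s)) {C₁ C₂ : Cluster n}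
    (hC : s(C₁, C₂) ∈ candidates (clusters m t)) :
    C₁.Nonempty ∧ C₂.Nonempty ∧ Disjoint C₁ C₂ := by
  obtain ⟨hne, hdisj⟩ := clusters_partition h
  obtain ⟨hmem, hdiag⟩ := Finset.mem_filter.1 hC
  obtain ⟨h1, h2⟩ := Finset.mk_mem_sym2_iff.1 hmem
  exact ⟨hne _ h1, hne _ h2, hdisj _ h1 _ h2 fun h => hdiag (Sym2.mk_isDiag_iff.2 h)⟩

end Algorithm

end RandClust

/-! ### Ratios of independent `χ²` variables -/

namespace RandClust

open Set

section HalfLine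

theorem lintegral_Ioi_scale {c : ℝ} (hc : 0 < c) (G : ℝ → ℝ≥0∞) :
    ∫⁻ x in Ioi 0, G x = ∫⁻ x in Ioi 0, ENNReal.ofReal c * G (c * x) := by
  have himg : (fun x : ℝ => c * x) '' Ioi 0 = Ioi 0 := by
    rw [Set.image_mul_left_Ioi hc, mul_zero]
  have h := lintegral_image_eq_lintegral_abs_deriv_mul (f := fun x : ℝ => c * x)
    (f' := fun _ => c) (s := Ioi 0) measurableSet_Ioi
    (fun x _ => by simpa using ((hasDerivAt_id x).const_mul c).hasDerivWithinAt)
    (mul_right_injective₀ hc.ne').injOn G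
  rwa [himg, abs_of_pos hc] at h

theorem lintegral_Ioi_sqrt (G : ℝ → ℝ≥0∞) :
    ∫⁻ x in Ioi 0, G x =
      ∫⁻ x in Ioi 0, ENNReal.ofReal (1 / (2 * Real.sqrt x)) * G (Real.sqrt x) := by
  have himg : Real.sqrt '' Ioi 0 = Ioi 0 := by
    ext y
    constructor
    · rintro ⟨x, hx, rfl⟩
      exact Real.sqrt_pos.2 hx
    · intro hy
      exact ⟨y ^ 2, pow_pos (mem_Ioi.1 hy) 2, Real.sqrt_sq (le_of_lt hy)⟩
  have h := lintegral_image_eq_lintegral_abs_deriv_mul (f := Real.sqrt)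
    (f' := fun x => 1 / (2 * Real.sqrt x)) (s := Ioi 0) measurableSet_Ioi
    (fun x hx => (Real.hasDerivAt_sqrt (ne_of_gt hx)).hasDerivWithinAt)
    (fun x hx y hy hxy => (Real.sqrt_inj (le_of_lt hx) (le_of_lt hy)).1 hxy) G
  rw [himg] at h
  rw [h]
  refine setLIntegral_congr_fun measurableSet_Ioi fun x hx => ?_
  rw [abs_of_nonneg (by positivity)]

instance (f : ℝ → ℝ) : SFinite (halfLineMeasure f) := by
  unfold halfLineMeasure; infer_instance

/-- The unnormalized `χ²` density with `2 a` degrees of freedom. -/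
noncomputable def chiSqKernel (a x : ℝ) : ℝ := x ^ (a - 1) * Real.exp (-x / 2)

theorem measurable_chiSqKernel (a : ℝ) : Measurable (chiSqKernel a) := by
  unfold chiSqKernel; fun_prop

theorem chiSqKernel_nonneg (a : ℝ) {x : ℝ} (hx : 0 < x) : 0 ≤ chiSqKernel a x := by
  unfold chiSqKernel; positivity

/-- The unnormalized density of `k` times the ratio of two independent `χ²` variables with `2 a`
and `2 b` degrees of freedom. -/
noncomputable def ratioKernel (a b k r : ℝ) : ℝ := k ^ b * r ^ (a - 1) * (k + r) ^ (-(a + b))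

theorem lintegral_halfLineMeasure {f : ℝ → ℝ} (hf : Measurable f) {G : ℝ → ℝ≥0∞}
    (hG : Measurable G) :
    ∫⁻ x, G x ∂(halfLineMeasure f) = ∫⁻ x in Ioi 0, ENNReal.ofReal (f x) * G x := by
  rw [halfLineMeasure, lintegral_withDensity_eq_lintegral_mul _ hf.ennreal_ofReal hG]
  rfl

theorem measurable_ratioKernel (a b k : ℝ) : Measurable (ratioKernel a b k) := by
  unfold ratioKernel; fun_prop

/-- The Jacobian identity behind the substitution `x = s r / (k + r)`, `y = s k / (k + r)`. -/
theorem chiSqKernel_mul_chiSqKernel (a b : ℝ) {k r s : ℝ} (hk : 0 < k) (hr : 0 < r) (hs : 0 < s) :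
    k / (k + r) * (s / (k + r) * (chiSqKernel a (s * r / (k + r)) *
      chiSqKernel b (s * k / (k + r)))) = chiSqKernel (a + b) s * ratioKernel a b k r := by
  have hkr : 0 < k + r := by positivity
  have e1 : Real.exp (-(s * r / (k + r)) / 2) * Real.exp (-(s * k / (k + r)) / 2) =
      Real.exp (-s / 2) := by
    rw [← Real.exp_add]
    congr 1
    field_simp
    ring
  have e2 : (k + r) ^ (-(a + b)) =
      ((k + r) ^ (a - 1))⁻¹ * ((k + r) ^ (b - 1))⁻¹ * (k + r)⁻¹ * (k + r)⁻¹ := by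
    rw [← Real.rpow_neg hkr.le, ← Real.rpow_neg hkr.le, ← Real.rpow_add hkr,
      ← Real.rpow_neg_one, ← Real.rpow_add hkr, ← Real.rpow_add hkr]
    congr 1; ring
  have e3 : s ^ (a + b - 1) = s ^ (a - 1) * s ^ (b - 1) * s := by
    rw [← Real.rpow_add hs, ← Real.rpow_add_one hs.ne']
    congr 1; ring
  have e4 : k ^ b = k ^ (b - 1) * k := by
    rw [← Real.rpow_add_one hk.ne']
    congr 1; ring
  unfold chiSqKernel ratioKernel
  rw [Real.div_rpow (by positivity) hkr.le, Real.div_rpow (by positivity) hkr.le,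
    Real.mul_rpow hs.le hr.le, Real.mul_rpow hs.le hk.le, e2, e3, e4, ← e1]
  ring

/-- If `x` and `y` are independent `χ²` variables, then `r = k x / y` and `s = x + y` are
independent. -/
theorem prod_chiSq_eq_map (a b : ℝ) {k : ℝ} (hk : 0 < k) :
    (halfLineMeasure (chiSqKernel a)).prod (halfLineMeasure (chiSqKernel b)) =
      ((halfLineMeasure (chiSqKernel (a + b))).prod (halfLineMeasure (ratioKernel a b k))).map
        fun z => (z.1 * z.2 / (k + z.2), z.1 * k / (k + z.2)) := by
  have hT : Measurable fun z : ℝ × ℝ => (z.1 * z.2 / (k + z.2), z.1 * k / (k + z.2)) := by fun_prop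
  refine Measure.ext_of_lintegral _ fun F hF => ?_
  have hma := measurable_chiSqKernel a
  have hmb := measurable_chiSqKernel b
  have hmab := measurable_chiSqKernel (a + b)
  have hmr := measurable_ratioKernel a b k
  rw [lintegral_map hF hT, lintegral_prod_symm' _ hF, 
    lintegral_prod_symm' (fun z : ℝ × ℝ => F (z.1 * z.2 / (k + z.2), z.1 * k / (k + z.2)))
      (hF.comp hT),
    lintegral_halfLineMeasure hmb (by exact hF.lintegral_prod_left'),
    lintegral_halfLineMeasure hmr (by exact (hF.comp hT).lintegral_prod_left')]
  -- Substitute `x = (y / k) r` for fixed `y`.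
  have h1 : ∀ y ∈ Ioi (0 : ℝ), ENNReal.ofReal (chiSqKernel b y) *
      ∫⁻ x, F (x, y) ∂(halfLineMeasure (chiSqKernel a)) =
      ∫⁻ r in Ioi 0, ENNReal.ofReal (y / k * (chiSqKernel a (y / k * r) * chiSqKernel b y)) *
        F (y / k * r, y) := by
    intro y hy
    have hy : 0 < y := hy
    have hm : Measurable fun x => F (x, y) := hF.comp (by fun_prop)
    rw [lintegral_halfLineMeasure hma hm, lintegral_Ioi_scale (div_pos hy hk),
      ← lintegral_const_mul _ (by fun_prop)]
    refine setLIntegral_congr_fun measurableSet_Ioi fun r hr => ?_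
    have hr : 0 < r := hr
    rw [ENNReal.ofReal_mul (by positivity),
      ENNReal.ofReal_mul (chiSqKernel_nonneg a (by positivity))]
    ring
  -- Substitute `y = k s / (k + r)` for fixed `r`.
  have h2 : ∀ r ∈ Ioi (0 : ℝ), ENNReal.ofReal (ratioKernel a b k r) *
      ∫⁻ s, F (s * r / (k + r), s * k / (k + r)) ∂(halfLineMeasure (chiSqKernel (a + b))) =
      ∫⁻ y in Ioi 0, ENNReal.ofReal (y / k * (chiSqKernel a (y / k * r) * chiSqKernel b y)) *
        F (y / k * r, y) := by
    intro r hr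
    have hr : 0 < r := hr
    have hm : Measurable fun s => F (s * r / (k + r), s * k / (k + r)) := hF.comp (by fun_prop)
    have hkr : 0 < k / (k + r) := by positivity
    rw [lintegral_halfLineMeasure hmab hm, lintegral_Ioi_scale hkr
      fun y => ENNReal.ofReal (y / k * (chiSqKernel a (y / k * r) * chiSqKernel b y)) *
        F (y / k * r, y),
      ← lintegral_const_mul _ (by fun_prop)]
    refine setLIntegral_congr_fun measurableSet_Ioi fun s hs => ?_
    have hs : 0 < s := hs
    have e1 : k / (k + r) * s / k = s / (k + r) := by field_simp
    have e2 : s / (k + r) * r = s * r / (k + r) := by ring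
    have e3 : k / (k + r) * s = s * k / (k + r) := by ring
    rw [e1, e2, e3, ← mul_assoc, ← mul_assoc, ← ENNReal.ofReal_mul hkr.le,
      chiSqKernel_mul_chiSqKernel a b hk hr hs, mul_comm (ENNReal.ofReal (ratioKernel a b k r)),
      ENNReal.ofReal_mul (chiSqKernel_nonneg _ hs)]
  calc _ = ∫⁻ y in Ioi 0, ∫⁻ r in Ioi 0,
        ENNReal.ofReal (y / k * (chiSqKernel a (y / k * r) * chiSqKernel b y)) *
          F (y / k * r, y) := setLIntegral_congr_fun measurableSet_Ioi h1
    _ = ∫⁻ r in Ioi 0, ∫⁻ y in Ioi 0,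
        ENNReal.ofReal (y / k * (chiSqKernel a (y / k * r) * chiSqKernel b y)) *
          F (y / k * r, y) := lintegral_lintegral_swap (by fun_prop)
    _ = _ := (setLIntegral_congr_fun measurableSet_Ioi h2).symm

end HalfLine

end RandClust

/-! ### Polar coordinates for the standard Gaussian law -/

namespace RandClust

open Set

section Gaussian

theorem pi_gaussianReal_eq_withDensity (ι : Type*) [Fintype ι] :
    Measure.pi (fun _ : ι => gaussianReal 0 1) =
      volume.withDensity fun x : ι → ℝ => ∏ i, gaussianPDF 0 1 (x i) := by
  refine Measure.pi_eq fun s hs => ?_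
  have hm : MeasurableSet (univ.pi s) := MeasurableSet.univ_pi hs
  rw [withDensity_apply _ hm, ← lintegral_indicator hm]
  -- Real-valued integrals are used because Fubini for finite products is available for them.
  have hi : ∀ i, Integrable ((s i).indicator (gaussianPDFReal 0 1)) :=
    fun i => (integrable_gaussianPDFReal 0 1).indicator (hs i)
  have hnn : ∀ i x, 0 ≤ (s i).indicator (gaussianPDFReal 0 1) x :=
    fun i x => indicator_nonneg (fun x _ => gaussianPDFReal_nonneg 0 1 x) x
  have h1 : ∀ x : ι → ℝ, (univ.pi s).indicator (fun x => ∏ i, gaussianPDF 0 1 (x i)) x =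
      ENNReal.ofReal (∏ i, (s i).indicator (gaussianPDFReal 0 1) (x i)) := by
    intro x
    by_cases hx : x ∈ univ.pi s
    · rw [indicator_of_mem hx, ENNReal.ofReal_prod_of_nonneg fun i _ => hnn i _]
      refine Finset.prod_congr rfl fun i _ => ?_
      rw [indicator_of_mem (hx i (mem_univ i))]
      rfl
    · rw [indicator_of_notMem hx]
      simp only [mem_pi, not_forall] at hx
      obtain ⟨i, -, hi⟩ := hx
      rw [Finset.prod_eq_zero (Finset.mem_univ i) (indicator_of_notMem hi _), ENNReal.ofReal_zero]
  simp_rw [h1]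
  rw [← ofReal_integral_eq_lintegral_ofReal]
  · rw [integral_fintype_prod_volume_eq_prod
      (fun i x => (s i).indicator (gaussianPDFReal 0 1) x),
      ENNReal.ofReal_prod_of_nonneg fun i _ => integral_nonneg (hnn i)]
    refine Finset.prod_congr rfl fun i _ => ?_
    rw [integral_indicator (hs i), gaussianReal_apply_eq_integral 0 one_ne_zero]
  · exact Integrable.fintype_prod hi
  · exact ae_of_all _ fun x => Finset.prod_nonneg fun i _ => hnn i _

variable {E : Type*} [NormedAddCommGroup E] [InnerProductSpace ℝ E] [FiniteDimensional ℝ E]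
  [MeasurableSpace E] [BorelSpace E]

variable (E) in
/-- The standard Gaussian density; the normalizing constant plays no role below. -/
theorem exists_stdGaussian_eq_withDensity :
    ∃ c : ℝ, 0 ≤ c ∧ stdGaussian E =
      volume.withDensity fun x : E => ENNReal.ofReal (c * Real.exp (-‖x‖ ^ 2 / 2)) := by
  refine ⟨(Real.sqrt (2 * Real.pi))⁻¹ ^ Module.finrank ℝ E, by positivity, ?_⟩
  set b := stdOrthonormalBasis ℝ E
  have hmp : MeasurePreserving (fun x : Fin (Module.finrank ℝ E) → ℝ =>
      b.repr.symm (WithLp.toLp 2 x)) volume volume :=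
    b.measurePreserving_repr_symm.comp
      (EuclideanSpace.volume_preserving_symm_measurableEquiv_toLp _).symm
  have hf : (fun x : Fin (Module.finrank ℝ E) → ℝ => ∑ i, x i • b i) =
      fun x => b.repr.symm (WithLp.toLp 2 x) := by
    funext x
    rw [b.sum_repr_symm]
  have hg : Measurable fun x : E => ENNReal.ofReal
      ((Real.sqrt (2 * Real.pi))⁻¹ ^ Module.finrank ℝ E * Real.exp (-‖x‖ ^ 2 / 2)) := by fun_prop
  rw [stdGaussian_eq_map_pi_orthonormalBasis b, hf, pi_gaussianReal_eq_withDensity]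
  ext S hS
  rw [Measure.map_apply hmp.measurable hS, withDensity_apply _ (hmp.measurable hS),
    withDensity_apply _ hS, ← hmp.setLIntegral_comp_preimage hS hg]
  refine lintegral_congr fun x => ?_
  have hn : ‖b.repr.symm (WithLp.toLp 2 x)‖ ^ 2 = ∑ i, x i ^ 2 := by
    rw [LinearIsometryEquiv.norm_map, EuclideanSpace.real_norm_sq_eq]
  rw [hn]
  unfold gaussianPDF
  rw [← ENNReal.ofReal_prod_of_nonneg fun i _ => gaussianPDFReal_nonneg 0 1 _]
  congr 1
  simp only [gaussianPDFReal, NNReal.coe_one, mul_one, sub_zero]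
  rw [Finset.prod_mul_distrib, ← Real.exp_sum, Finset.prod_const, Finset.card_univ,
    Fintype.card_fin, ← Finset.sum_div, Finset.sum_neg_distrib]

/-- Integration in polar coordinates. -/
theorem lintegral_eq_lintegral_sphere [Nontrivial E] (μ : Measure E) [μ.IsAddHaarMeasure]
    {F : E → ℝ≥0∞} (hF : Measurable F) :
    ∫⁻ x, F x ∂μ = ∫⁻ θ, (∫⁻ r in Ioi (0 : ℝ),
      ENNReal.ofReal (r ^ (Module.finrank ℝ E - 1)) * F (r • (θ : E))) ∂μ.toSphere := by
  have h1 : ∫⁻ x, F x ∂μ = ∫⁻ x : ({0}ᶜ : Set E), F x ∂(μ.comap (↑)) := by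
    rw [lintegral_subtype_comap (measurableSet_singleton _).compl, restrict_compl_singleton]
  have h2 : ∀ x : ({0}ᶜ : Set E), F x =
      (fun z : Metric.sphere (0 : E) 1 × Ioi (0 : ℝ) => F ((z.2 : ℝ) • (z.1 : E)))
        (homeomorphUnitSphereProd E x) := by
    intro x
    have hx : ‖(x : E)‖ ≠ 0 := norm_ne_zero_iff.2 x.2
    simp [smul_smul, hx]
  have hm : Measurable fun z : Metric.sphere (0 : E) 1 × Ioi (0 : ℝ) =>
      F ((z.2 : ℝ) • (z.1 : E)) := hF.comp (by fun_prop)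
  rw [h1, lintegral_congr h2, μ.measurePreserving_homeomorphUnitSphereProd.lintegral_comp hm,
    lintegral_prod _ hm.aemeasurable]
  refine lintegral_congr fun θ => ?_
  have hmθ : Measurable fun r : ℝ => F (r • (θ : E)) := hF.comp (by fun_prop)
  rw [Measure.volumeIoiPow, lintegral_withDensity_eq_lintegral_mul _ (by fun_prop)
    (by exact hmθ.comp measurable_subtype_coe)]
  exact lintegral_subtype_comap measurableSet_Ioi
    fun r : ℝ => ENNReal.ofReal (r ^ (Module.finrank ℝ E - 1)) * F (r • (θ : E))

variable (E) in
/-- Under a standard Gaussian law the direction is independent of the squared norm, and the latter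
has a `χ²` law. -/
theorem exists_stdGaussian_eq_map_polar [Nontrivial E] :
    ∃ ς : Measure (Metric.sphere (0 : E) 1), SFinite ς ∧ stdGaussian E =
      (ς.prod (halfLineMeasure (chiSqKernel (Module.finrank ℝ E / 2)))).map
        fun z => Real.sqrt z.2 • (z.1 : E) := by
  obtain ⟨c, hc, hG⟩ := exists_stdGaussian_eq_withDensity E
  -- The factor `1 / 2` comes from the substitution `r = √x`.
  refine ⟨ENNReal.ofReal (c / 2) • (volume : Measure E).toSphere, inferInstance, ?_⟩
  have hT : Measurable fun z : Metric.sphere (0 : E) 1 × ℝ => Real.sqrt z.2 • (z.1 : E) := by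
    fun_prop
  have hmχ := measurable_chiSqKernel (Module.finrank ℝ E / 2)
  refine Measure.ext_of_lintegral _ fun F hF => ?_
  have hFT : Measurable fun z : Metric.sphere (0 : E) 1 × ℝ => F (Real.sqrt z.2 • (z.1 : E)) :=
    hF.comp hT
  rw [hG, lintegral_withDensity_eq_lintegral_mul _ (by fun_prop) hF, lintegral_map hF hT,
    lintegral_prod _ hFT.aemeasurable, lintegral_smul_measure, smul_eq_mul,
    lintegral_eq_lintegral_sphere volume (by fun_prop),
    ← lintegral_const_mul _ (by exact hFT.lintegral_prod_right')]
  refine lintegral_congr fun θ => ?_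
  have hmθ : Measurable fun r : ℝ => F (Real.sqrt r • (θ : E)) := hF.comp (by fun_prop)
  rw [lintegral_halfLineMeasure hmχ hmθ, lintegral_Ioi_sqrt,
    ← lintegral_const_mul _ (by fun_prop)]
  refine setLIntegral_congr_fun measurableSet_Ioi fun x hx => ?_
  have hx : 0 < x := hx
  have hθ : ‖Real.sqrt x • (θ : E)‖ ^ 2 = x := by
    rw [norm_smul, norm_eq_of_mem_sphere, mul_one, Real.norm_of_nonneg (Real.sqrt_nonneg x),
      Real.sq_sqrt hx.le]
  have hpos : 0 < Module.finrank ℝ E := Module.finrank_pos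
  have hpow : 1 / (2 * Real.sqrt x) * Real.sqrt x ^ (Module.finrank ℝ E - 1) =
      1 / 2 * x ^ ((Module.finrank ℝ E : ℝ) / 2 - 1) := by
    rw [one_div, mul_inv, mul_assoc, one_div, Real.sqrt_eq_rpow, ← Real.rpow_neg hx.le,
      ← Real.rpow_natCast, ← Real.rpow_mul hx.le, ← Real.rpow_add hx, Nat.cast_pred hpos]
    congr 2; ring
  simp only [Pi.mul_apply]
  rw [hθ, ← mul_assoc, ← mul_assoc, ← mul_assoc, ← ENNReal.ofReal_mul (by positivity),
    ← ENNReal.ofReal_mul (by positivity), ← ENNReal.ofReal_mul (by positivity), hpow]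
  congr 2
  unfold chiSqKernel
  ring

end Gaussian

end RandClust

/-! ### Decomposition of the Gaussian law along orthogonal projections -/

namespace RandClust

section GaussianDecomposition

/-- For two independent standard Gaussian vectors, the ratio of the squared norms is independent of
the directions and of the sum of the squared norms, jointly. -/
theorem exists_prod_stdGaussian_eq_map (U V : Type*)
    [NormedAddCommGroup U] [InnerProductSpace ℝ U] [FiniteDimensional ℝ U] [MeasurableSpace U]
    [BorelSpace U] [Nontrivial U]
    [NormedAddCommGroup V] [InnerProductSpace ℝ V] [FiniteDimensional ℝ V] [MeasurableSpace V]
    [BorelSpace V] [Nontrivial V] {k : ℝ} (hk : 0 < k) :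
    ∃ ς : Measure (Metric.sphere (0 : U) 1 × Metric.sphere (0 : V) 1), SFinite ς ∧
      ∃ h : ℝ → ℝ, (stdGaussian U).prod (stdGaussian V) =
        ((ς.prod (halfLineMeasure h)).prod (halfLineMeasure
          (ratioKernel (Module.finrank ℝ U / 2) (Module.finrank ℝ V / 2) k))).map fun z =>
            (Real.sqrt (z.1.2 * z.2 / (k + z.2)) • (z.1.1.1 : U),
              Real.sqrt (z.1.2 * k / (k + z.2)) • (z.1.1.2 : V)) := by
  obtain ⟨ς₁, h₁, e₁⟩ := exists_stdGaussian_eq_map_polar U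
  obtain ⟨ς₂, h₂, e₂⟩ := exists_stdGaussian_eq_map_polar V
  refine ⟨ς₁.prod ς₂, inferInstance, chiSqKernel (Module.finrank ℝ U / 2 + Module.finrank ℝ V / 2),
    ?_⟩
  have hχ := prod_chiSq_eq_map (Module.finrank ℝ U / 2) (Module.finrank ℝ V / 2) hk
  set χ₁ := halfLineMeasure (chiSqKernel (Module.finrank ℝ U / 2))
  set χ₂ := halfLineMeasure (chiSqKernel (Module.finrank ℝ V / 2))
  set χ := halfLineMeasure (chiSqKernel (Module.finrank ℝ U / 2 + Module.finrank ℝ V / 2))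
  set l := halfLineMeasure (ratioKernel (Module.finrank ℝ U / 2) (Module.finrank ℝ V / 2) k)
  have hT₁ : Measurable fun z : Metric.sphere (0 : U) 1 × ℝ => Real.sqrt z.2 • (z.1 : U) := by
    fun_prop
  have hT₂ : Measurable fun z : Metric.sphere (0 : V) 1 × ℝ => Real.sqrt z.2 • (z.1 : V) := by
    fun_prop
  have hT : Measurable fun z : ((Metric.sphere (0 : U) 1 × Metric.sphere (0 : V) 1) × ℝ) × ℝ =>
      (Real.sqrt (z.1.2 * z.2 / (k + z.2)) • (z.1.1.1 : U),
        Real.sqrt (z.1.2 * k / (k + z.2)) • (z.1.1.2 : V)) := by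
    fun_prop
  have hS : Measurable fun z : ℝ × ℝ => (z.1 * z.2 / (k + z.2), z.1 * k / (k + z.2)) := by fun_prop
  rw [e₁, e₂, Measure.map_prod_map _ _ hT₁ hT₂]
  refine Measure.ext_of_lintegral _ fun F hF => ?_
  rw [lintegral_map hF (hT₁.prodMap hT₂), lintegral_map hF hT]
  have hm₁ : Measurable fun z : (Metric.sphere (0 : U) 1 × ℝ) × (Metric.sphere (0 : V) 1 × ℝ) =>
      F (Prod.map (fun z : Metric.sphere (0 : U) 1 × ℝ => Real.sqrt z.2 • (z.1 : U))
        (fun z : Metric.sphere (0 : V) 1 × ℝ => Real.sqrt z.2 • (z.1 : V)) z) :=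
    hF.comp (hT₁.prodMap hT₂)
  have hm₂ : Measurable fun z : ((Metric.sphere (0 : U) 1 × Metric.sphere (0 : V) 1) × ℝ) × ℝ =>
      F (Real.sqrt (z.1.2 * z.2 / (k + z.2)) • (z.1.1.1 : U),
        Real.sqrt (z.1.2 * k / (k + z.2)) • (z.1.1.2 : V)) := hF.comp hT
  rw [lintegral_prod _ hm₁.aemeasurable,
    lintegral_prod _ (by exact hm₁.lintegral_prod_right'.aemeasurable),
    lintegral_prod _ hm₂.aemeasurable,
    lintegral_prod _ (by exact hm₂.lintegral_prod_right'.aemeasurable),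
    lintegral_prod _ (by
      exact (hm₂.lintegral_prod_right' (ν := l)).lintegral_prod_right'.aemeasurable)]
  refine lintegral_congr fun θ => ?_
  have hmθ : Measurable fun z : ℝ × (Metric.sphere (0 : V) 1 × ℝ) =>
      F (Real.sqrt z.1 • (θ : U), Real.sqrt z.2.2 • (z.2.1 : V)) := hF.comp (by fun_prop)
  calc _ = ∫⁻ x, ∫⁻ φ, ∫⁻ y, F (Real.sqrt x • (θ : U), Real.sqrt y • (φ : V)) ∂χ₂ ∂ς₂ ∂χ₁ := by
        refine lintegral_congr fun x => ?_
        exact lintegral_prod _ (hmθ.comp measurable_prodMk_left).aemeasurable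
    _ = ∫⁻ φ, ∫⁻ x, ∫⁻ y, F (Real.sqrt x • (θ : U), Real.sqrt y • (φ : V)) ∂χ₂ ∂χ₁ ∂ς₂ := by
        refine lintegral_lintegral_swap ?_
        have : Measurable fun z : (ℝ × Metric.sphere (0 : V) 1) × ℝ =>
            F (Real.sqrt z.1.1 • (θ : U), Real.sqrt z.2 • (z.1.2 : V)) := hF.comp (by fun_prop)
        exact this.lintegral_prod_right'.aemeasurable
    _ = _ := by
        refine lintegral_congr fun φ => ?_
        have hmφ : Measurable fun z : ℝ × ℝ =>
            F (Real.sqrt z.1 • (θ : U), Real.sqrt z.2 • (φ : V)) := hF.comp (by fun_prop)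
        rw [← lintegral_prod _ hmφ.aemeasurable, hχ, lintegral_map hmφ hS,
          lintegral_prod _ (by exact (hmφ.comp hS).aemeasurable)]

variable {H : Type*} [NormedAddCommGroup H] [InnerProductSpace ℝ H] [FiniteDimensional ℝ H]
  [MeasurableSpace H] [BorelSpace H]

/-- The characteristic function of the standard Gaussian law on the range of an orthogonal
projection. -/
theorem integral_range_exp_inner {b : H →ₗ[ℝ] H} (hs : b.IsSymmetric)
    (hi : ∀ x, b (b x) = b x) (t : H) :
    ∫ u : LinearMap.range b, Complex.exp ((inner ℝ (u : H) t : ℝ) * Complex.I)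
      ∂(stdGaussian (LinearMap.range b)) = Complex.exp (-(‖b t‖ ^ 2 : ℝ) / 2) := by
  have h := charFun_stdGaussian (⟨b t, LinearMap.mem_range_self b t⟩ : LinearMap.range b)
  rw [charFun_apply] at h
  rw [Submodule.coe_norm] at h
  rw [Complex.ofReal_pow, ← h]
  refine integral_congr_ae (ae_of_all _ ?_)
  rintro ⟨u, y, rfl⟩
  simp only [Submodule.coe_inner]
  rw [← hs, hi]

/-- A standard Gaussian vector is the sum of independent standard Gaussian vectors on the ranges of
orthogonal projections that add up to the identity. -/
theorem stdGaussian_eq_map_add {b w g : H →ₗ[ℝ] H} (hb : b.IsSymmetric) (hw : w.IsSymmetric)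
    (hg : g.IsSymmetric) (hbb : ∀ x, b (b x) = b x) (hww : ∀ x, w (w x) = w x)
    (hgg : ∀ x, g (g x) = g x) (hsum : ∀ x, b x + w x + g x = x) :
    stdGaussian H = ((stdGaussian (LinearMap.range g)).prod ((stdGaussian (LinearMap.range b)).prod
      (stdGaussian (LinearMap.range w)))).map fun z => (z.1 : H) + (z.2.1 + z.2.2) := by
  have hT : Measurable fun z : LinearMap.range g × LinearMap.range b × LinearMap.range w =>
      (z.1 : H) + (z.2.1 + z.2.2) := by fun_prop
  have := Measure.isProbabilityMeasure_map (μ := (stdGaussian (LinearMap.range g)).prod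
    ((stdGaussian (LinearMap.range b)).prod (stdGaussian (LinearMap.range w)))) hT.aemeasurable
  refine Measure.ext_of_charFun ?_
  ext t
  rw [charFun_stdGaussian, charFun_apply, integral_map hT.aemeasurable (by fun_prop)]
  have h1 : ∀ z : LinearMap.range g × LinearMap.range b × LinearMap.range w,
      Complex.exp ((inner ℝ ((z.1 : H) + (z.2.1 + z.2.2)) t : ℝ) * Complex.I) =
        Complex.exp ((inner ℝ (z.1 : H) t : ℝ) * Complex.I) *
          (fun y : LinearMap.range b × LinearMap.range w =>
            Complex.exp ((inner ℝ (y.1 : H) t : ℝ) * Complex.I) *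
              Complex.exp ((inner ℝ (y.2 : H) t : ℝ) * Complex.I)) z.2 := by
    intro z
    simp only [← Complex.exp_add, inner_add_left, Complex.ofReal_add]
    congr 1; ring
  have hn : ‖t‖ ^ 2 = ‖b t‖ ^ 2 + ‖w t‖ ^ 2 + ‖g t‖ ^ 2 := by
    simp_rw [← real_inner_self_eq_norm_sq]
    rw [hb, hw, hg, hbb, hww, hgg, ← inner_add_right, ← inner_add_right, hsum]
  rw [integral_congr_ae (ae_of_all _ h1), integral_prod_mul (fun u : LinearMap.range g =>
      Complex.exp ((inner ℝ (u : H) t : ℝ) * Complex.I))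
      (fun y : LinearMap.range b × LinearMap.range w =>
        Complex.exp ((inner ℝ (y.1 : H) t : ℝ) * Complex.I) *
          Complex.exp ((inner ℝ (y.2 : H) t : ℝ) * Complex.I)),
    integral_prod_mul (fun u : LinearMap.range b =>
      Complex.exp ((inner ℝ (u : H) t : ℝ) * Complex.I)) (fun u : LinearMap.range w =>
      Complex.exp ((inner ℝ (u : H) t : ℝ) * Complex.I)),
    integral_range_exp_inner hb hbb, integral_range_exp_inner hw hww,
    integral_range_exp_inner hg hgg, ← Complex.exp_add, ← Complex.exp_add,
    ← Complex.ofReal_pow, hn]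
  congr 1
  push_cast
  ring

/-- Data matrices with the Frobenius inner product. -/
abbrev DataSpace (n p : ℕ) := PiLp 2 fun _ : Fin n => EuclideanSpace ℝ (Fin p)

/-- The data are `μ + σ Z` with `Z` a standard Gaussian vector in the space of matrices. -/
theorem map_toLp_gaussianData {n p : ℕ} (μ : Data n p) (σ : ℝ) :
    (gaussianData μ σ).map (WithLp.toLp 2) =
      (stdGaussian (DataSpace n p)).map fun x => WithLp.toLp 2 μ + σ • x := by
  have hm : Measurable fun x : DataSpace n p => WithLp.toLp 2 μ + σ • x := by fun_prop
  have hm' : Measurable (WithLp.toLp 2 : Data n p → DataSpace n p) := by fun_prop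
  have hS : (σ ^ 2 • (1 : Matrix (Fin p) (Fin p) ℝ)).PosSemidef :=
    Matrix.PosSemidef.one.smul (sq_nonneg σ)
  have h1 : IsProbabilityMeasure (gaussianData μ σ) := by unfold gaussianData; infer_instance
  have := Measure.isProbabilityMeasure_map (μ := gaussianData μ σ) hm'.aemeasurable
  have := Measure.isProbabilityMeasure_map (μ := stdGaussian (DataSpace n p)) hm.aemeasurable
  refine Measure.ext_of_charFun ?_
  ext t
  have e : (fun x : DataSpace n p => WithLp.toLp 2 μ + σ • x) =
      (fun x => WithLp.toLp 2 μ + x) ∘ fun x => σ • x := rfl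
  rw [gaussianData, charFun_pi, e, ← Measure.map_map (by fun_prop) (by fun_prop),
    charFun_map_const_add, charFun_map_smul, charFun_stdGaussian]
  simp_rw [charFun_multivariateGaussian hS]
  rw [← Complex.exp_sum, ← Complex.exp_add]
  congr 1
  have h2 : ∀ i, (t i).ofLp ⬝ᵥ (σ ^ 2 • (1 : Matrix (Fin p) (Fin p) ℝ)).mulVec (t i).ofLp =
      σ ^ 2 * ‖t i‖ ^ 2 := by
    intro i
    rw [Matrix.smul_mulVec, Matrix.one_mulVec, dotProduct_smul, EuclideanSpace.real_norm_sq_eq,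
      dotProduct, smul_eq_mul]
    simp_rw [← sq]
  have h3 : ‖σ • t‖ ^ 2 = ∑ i, σ ^ 2 * ‖t i‖ ^ 2 := by
    rw [norm_smul, mul_pow, PiLp.norm_sq_eq_of_L2, Finset.mul_sum, Real.norm_eq_abs, sq_abs]
  rw [PiLp.inner_apply, ← Complex.ofReal_pow, h3]
  simp_rw [h2]
  push_cast
  rw [Finset.sum_sub_distrib, Finset.sum_mul, sub_eq_add_neg, neg_div, Finset.sum_div, add_comm]
  simp_rw [real_inner_comm]

end GaussianDecomposition

end RandClust

/-! ### Matrix actions and the projections `B` and `W` -/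

namespace RandClust

section MatrixAction

variable {n p : ℕ}

theorem matAct_apply (A : Matrix (Fin n) (Fin n) ℝ) (x : Data n p) (i : Fin n) :
    matAct A x i = ∑ k, A i k • x k := rfl

theorem matAct_mul (A A' : Matrix (Fin n) (Fin n) ℝ) (x : Data n p) :
    matAct (A * A') x = matAct A (matAct A' x) := by
  funext i
  simp_rw [matAct_apply, Matrix.mul_apply, Finset.sum_smul, Finset.smul_sum, smul_smul]
  exact Finset.sum_comm

theorem matAct_one (x : Data n p) : matAct 1 x = x := by
  funext i
  simp [matAct_apply, Matrix.one_apply]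

theorem matAct_zero_left (x : Data n p) : matAct 0 x = 0 := by
  funext i
  simp [matAct_apply]

theorem matAct_add_left (A A' : Matrix (Fin n) (Fin n) ℝ) (x : Data n p) :
    matAct (A + A') x = matAct A x + matAct A' x := by
  funext i
  simp [matAct_apply, add_smul, Finset.sum_add_distrib]

theorem matAct_sub_left (A A' : Matrix (Fin n) (Fin n) ℝ) (x : Data n p) :
    matAct (A - A') x = matAct A x - matAct A' x := by
  funext i
  simp [matAct_apply, sub_smul, Finset.sum_sub_distrib]

theorem matAct_add (A : Matrix (Fin n) (Fin n) ℝ) (x y : Data n p) :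
    matAct A (x + y) = matAct A x + matAct A y := by
  funext i
  simp [matAct_apply, Finset.sum_add_distrib]

theorem matAct_smul (A : Matrix (Fin n) (Fin n) ℝ) (c : ℝ) (x : Data n p) :
    matAct A (c • x) = c • matAct A x := by
  funext i
  simp [matAct_apply, Finset.smul_sum, smul_comm c]

/-- The action of a matrix on data matrices, as a linear map for the Frobenius inner product. -/
def matLin (p : ℕ) (A : Matrix (Fin n) (Fin n) ℝ) : DataSpace n p →ₗ[ℝ] DataSpace n p where
  toFun x := WithLp.toLp 2 (matAct A x.ofLp)
  map_add' x y := by rw [WithLp.ofLp_add, matAct_add]; rfl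
  map_smul' c x := by rw [WithLp.ofLp_smul, matAct_smul]; rfl

theorem matLin_apply (A : Matrix (Fin n) (Fin n) ℝ) (x : DataSpace n p) :
    matLin p A x = WithLp.toLp 2 (matAct A x.ofLp) := rfl

theorem isSymmetric_matLin {A : Matrix (Fin n) (Fin n) ℝ} (hA : A.IsSymm) :
    (matLin p A).IsSymmetric := by
  intro x y
  rw [matLin_apply, matLin_apply, PiLp.inner_apply, PiLp.inner_apply]
  have h1 : ∀ i, inner ℝ (matAct A x.ofLp i) (y i) = ∑ k, A i k * inner ℝ (x k) (y i) := fun i => by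
    rw [matAct_apply, sum_inner]
    exact Finset.sum_congr rfl fun k _ => real_inner_smul_left _ _ _
  have h2 : ∀ i, inner ℝ (x i) (matAct A y.ofLp i) = ∑ k, A i k * inner ℝ (x i) (y k) := fun i => by
    rw [matAct_apply, inner_sum]
    exact Finset.sum_congr rfl fun k _ => real_inner_smul_right _ _ _
  rw [Finset.sum_congr rfl fun i _ => h1 i, Finset.sum_congr rfl fun i _ => h2 i, Finset.sum_comm]
  refine Finset.sum_congr rfl fun i _ => Finset.sum_congr rfl fun k _ => ?_
  rw [hA.apply]

theorem matLin_matLin {A A' : Matrix (Fin n) (Fin n) ℝ} (x : DataSpace n p) :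
    matLin p A (matLin p A' x) = matLin p (A * A') x := by
  simp only [matLin_apply, matAct_mul]

theorem trace_matLin (A : Matrix (Fin n) (Fin n) ℝ) :
    LinearMap.trace ℝ _ (matLin p A) = p * A.trace := by
  let b := (Pi.basis fun _ : Fin n => (EuclideanSpace.basisFun (Fin p) ℝ).toBasis).map
    (WithLp.linearEquiv 2 ℝ (Data n p)).symm
  rw [LinearMap.trace_eq_matrix_trace ℝ b, Matrix.trace]
  have h : ∀ ij : Σ _ : Fin n, Fin p, (LinearMap.toMatrix b b (matLin p A)).diag ij =
      A ij.1 ij.1 := by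
    rintro ⟨i, j⟩
    have hrepr : ∀ x : DataSpace n p, b.repr x ⟨i, j⟩ = x i j := fun x => rfl
    have hb : b ⟨i, j⟩ = WithLp.toLp 2 (Pi.single i (EuclideanSpace.single j (1 : ℝ))) := by
      simp [b]
    rw [Matrix.diag_apply, LinearMap.toMatrix_apply, hrepr, hb, matLin_apply]
    change (matAct A (Pi.single i (EuclideanSpace.single j (1 : ℝ))) i) j = A i i
    rw [matAct_apply, Finset.sum_eq_single i]
    · simp
    · intro k _ hk
      simp [Pi.single_eq_of_ne hk]
    · simp
  rw [Finset.sum_congr rfl fun ij _ => h ij, Fintype.sum_sigma]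
  simp [Matrix.trace, Finset.mul_sum]

/-- The rank of a projection is its trace. -/
theorem finrank_range_matLin {A : Matrix (Fin n) (Fin n) ℝ} (hA : A * A = A) :
    (Module.finrank ℝ (LinearMap.range (matLin p A)) : ℝ) = p * A.trace := by
  have hi : IsIdempotentElem (matLin p A) := by
    ext1 x
    rw [Module.End.mul_apply, matLin_matLin, hA]
  rw [← trace_matLin, (LinearMap.IsIdempotentElem.isProj_range _ hi).trace]

theorem frob_eq_norm (x : Data n p) : frob x = ‖(WithLp.toLp 2 x : DataSpace n p)‖ := by
  rw [frob, PiLp.norm_eq_of_L2]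

theorem frob_nonneg (x : Data n p) : 0 ≤ frob x := Real.sqrt_nonneg _

theorem frob_sq (x : Data n p) : frob x ^ 2 = ∑ i, ‖x i‖ ^ 2 :=
  Real.sq_sqrt (Finset.sum_nonneg fun _ _ => sq_nonneg _)

theorem frob_smul_dir (x : Data n p) : frob x • dir x = x := by
  rcases eq_or_ne (frob x) 0 with h | h
  · have hx : x = 0 := by
      rw [frob_eq_norm, norm_eq_zero] at h
      exact congrArg WithLp.ofLp h
    rw [h, zero_smul, hx]
  · rw [dir, smul_smul, mul_inv_cancel₀ h, one_smul]

end MatrixAction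

section Projections

variable {n p : ℕ}

theorem ind_dotProduct_self (C : Cluster n) : ind C ⬝ᵥ ind C = C.card := by
  simp [dotProduct, ind]

theorem ind_dotProduct_of_disjoint {C D : Cluster n} (h : Disjoint C D) : ind C ⬝ᵥ ind D = 0 := by
  refine Finset.sum_eq_zero fun i _ => ?_
  by_cases hi : i ∈ C
  · simp [ind, Finset.disjoint_left.1 h hi]
  · simp [ind, hi]

theorem diagonal_ind_mulVec_self (C : Cluster n) :
    (Matrix.diagonal (ind C)).mulVec (ind C) = ind C := by
  funext i
  simp [Matrix.mulVec_diagonal, ind]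

theorem diagonal_ind_mulVec_of_disjoint {C D : Cluster n} (h : Disjoint C D) :
    (Matrix.diagonal (ind C)).mulVec (ind D) = 0 := by
  funext i
  by_cases hi : i ∈ C
  · simp [Matrix.mulVec_diagonal, ind, Finset.disjoint_left.1 h hi]
  · simp [Matrix.mulVec_diagonal, ind, hi]

theorem isSymm_vecMulVec_self (v : Fin n → ℝ) : (Matrix.vecMulVec v v).IsSymm := by
  ext i j
  simp [Matrix.vecMulVec_apply, mul_comm]

theorem isSymm_centering (C : Cluster n) : (centering C).IsSymm :=
  (Matrix.isSymm_diagonal _).sub ((isSymm_vecMulVec_self _).smul _)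

theorem isSymm_matB (C₁ C₂ : Cluster n) : (matB C₁ C₂).IsSymm := (isSymm_vecMulVec_self _).smul _

theorem isSymm_matW (C₁ C₂ : Cluster n) : (matW C₁ C₂).IsSymm :=
  (isSymm_centering C₁).add (isSymm_centering C₂)

theorem centering_mulVec_ind {C : Cluster n} (h : C.Nonempty) :
    (centering C).mulVec (ind C) = 0 := by
  have hc : (C.card : ℝ) ≠ 0 := by exact_mod_cast h.card_pos.ne'
  rw [centering, Matrix.sub_mulVec, Matrix.smul_mulVec, Matrix.vecMulVec_mulVec,
    ind_dotProduct_self, diagonal_ind_mulVec_self]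
  funext i
  simp [mul_comm (ind C i), hc]

theorem centering_mulVec_of_disjoint {C D : Cluster n} (h : Disjoint C D) :
    (centering C).mulVec (ind D) = 0 := by
  rw [centering, Matrix.sub_mulVec, Matrix.smul_mulVec, Matrix.vecMulVec_mulVec,
    ind_dotProduct_of_disjoint h, diagonal_ind_mulVec_of_disjoint h]
  simp

theorem centering_mul_self {C : Cluster n} (h : C.Nonempty) :
    centering C * centering C = centering C := by
  have h0 : centering C * centering C = Matrix.diagonal (ind C) * centering C -
      ((C.card : ℝ)⁻¹ • Matrix.vecMulVec (ind C) (ind C)) * centering C := by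
    rw [← sub_mul]; rfl
  rw [h0, Matrix.smul_mul, Matrix.vecMulVec_mul]
  have h1 : Matrix.vecMul (ind C) (centering C) = 0 := by
    rw [← Matrix.mulVec_transpose, isSymm_centering, centering_mulVec_ind h]
  rw [h1, Matrix.vecMulVec_zero, smul_zero, sub_zero, centering, mul_sub, Matrix.mul_smul,
    Matrix.mul_vecMulVec, diagonal_ind_mulVec_self, Matrix.diagonal_mul_diagonal]
  congr 2
  funext i
  simp [ind]

theorem centering_mul_of_disjoint {C D : Cluster n} (h : Disjoint C D) :
    centering C * centering D = 0 := by
  conv_lhs => rw [centering, sub_mul]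
  rw [Matrix.smul_mul, Matrix.vecMulVec_mul]
  have h1 : Matrix.vecMul (ind C) (centering D) = 0 := by
    rw [← Matrix.mulVec_transpose, isSymm_centering, centering_mulVec_of_disjoint h.symm]
  rw [h1, Matrix.vecMulVec_zero, smul_zero, sub_zero, centering, mul_sub, Matrix.mul_smul,
    Matrix.mul_vecMulVec, diagonal_ind_mulVec_of_disjoint h, Matrix.diagonal_mul_diagonal]
  have : (fun i => ind C i * ind D i) = 0 := by
    funext i
    by_cases hi : i ∈ C
    · simp [ind, Finset.disjoint_left.1 h hi]
    · simp [ind, hi]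
  rw [this]
  simp

theorem nu_eq (C₁ C₂ : Cluster n) :
    nu C₁ C₂ = (C₁.card : ℝ)⁻¹ • ind C₁ - (C₂.card : ℝ)⁻¹ • ind C₂ := by
  funext i
  simp [nu, div_eq_inv_mul]

theorem trace_centering {C : Cluster n} (h : C.Nonempty) :
    (centering C).trace = C.card - 1 := by
  have hc : (C.card : ℝ) ≠ 0 := by exact_mod_cast h.card_pos.ne'
  rw [centering, Matrix.trace_sub, Matrix.trace_smul, Matrix.trace_vecMulVec, ind_dotProduct_self,
    Matrix.trace_diagonal, smul_eq_mul, inv_mul_cancel₀ hc]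
  simp [ind]

variable {C₁ C₂ : Cluster n}

theorem sum_nu_sq (h₁ : C₁.Nonempty) (h₂ : C₂.Nonempty)
    (hdisj : Disjoint C₁ C₂) : ∑ i, nu C₁ C₂ i ^ 2 = (C₁.card : ℝ)⁻¹ + (C₂.card : ℝ)⁻¹ := by
  have hc₁ : (C₁.card : ℝ) ≠ 0 := by exact_mod_cast h₁.card_pos.ne'
  have hc₂ : (C₂.card : ℝ) ≠ 0 := by exact_mod_cast h₂.card_pos.ne'
  have : ∑ i, nu C₁ C₂ i ^ 2 = nu C₁ C₂ ⬝ᵥ nu C₁ C₂ := by simp [dotProduct, sq]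
  rw [this, nu_eq]
  simp only [sub_dotProduct, dotProduct_sub, smul_dotProduct, dotProduct_smul, smul_eq_mul,
    ind_dotProduct_self, ind_dotProduct_of_disjoint hdisj, ind_dotProduct_of_disjoint hdisj.symm]
  field_simp
  ring

theorem sum_nu_sq_pos (h₁ : C₁.Nonempty) (h₂ : C₂.Nonempty)
    (hdisj : Disjoint C₁ C₂) : 0 < ∑ i, nu C₁ C₂ i ^ 2 := by
  rw [sum_nu_sq h₁ h₂ hdisj]
  have hc₁ : (0 : ℝ) < C₁.card := by exact_mod_cast h₁.card_pos
  have hc₂ : (0 : ℝ) < C₂.card := by exact_mod_cast h₂.card_pos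
  positivity

theorem matW_mulVec_nu (h₁ : C₁.Nonempty) (h₂ : C₂.Nonempty)
    (hdisj : Disjoint C₁ C₂) : (matW C₁ C₂).mulVec (nu C₁ C₂) = 0 := by
  rw [matW, Matrix.add_mulVec, nu_eq, Matrix.mulVec_sub, Matrix.mulVec_sub]
  simp only [Matrix.mulVec_smul, centering_mulVec_ind h₁, centering_mulVec_ind h₂,
    centering_mulVec_of_disjoint hdisj, centering_mulVec_of_disjoint hdisj.symm]
  simp

theorem matB_mul_self (h₁ : C₁.Nonempty) (h₂ : C₂.Nonempty)
    (hdisj : Disjoint C₁ C₂) : matB C₁ C₂ * matB C₁ C₂ = matB C₁ C₂ := by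
  have hs := (sum_nu_sq_pos h₁ h₂ hdisj).ne'
  have hd : nu C₁ C₂ ⬝ᵥ nu C₁ C₂ = ∑ i, nu C₁ C₂ i ^ 2 := by simp [dotProduct, sq]
  rw [matB, Matrix.smul_mul, Matrix.mul_smul, Matrix.vecMulVec_mul_vecMulVec, hd,
    Matrix.vecMulVec_smul, smul_smul, smul_smul, inv_mul_cancel_right₀ hs]

theorem matW_mul_self (h₁ : C₁.Nonempty) (h₂ : C₂.Nonempty)
    (hdisj : Disjoint C₁ C₂) : matW C₁ C₂ * matW C₁ C₂ = matW C₁ C₂ := by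
  rw [matW, add_mul, mul_add, mul_add, centering_mul_self h₁, centering_mul_self h₂,
    centering_mul_of_disjoint hdisj, centering_mul_of_disjoint hdisj.symm, add_zero, zero_add]

theorem matW_mul_matB (h₁ : C₁.Nonempty) (h₂ : C₂.Nonempty)
    (hdisj : Disjoint C₁ C₂) : matW C₁ C₂ * matB C₁ C₂ = 0 := by
  rw [matB, Matrix.mul_smul, Matrix.mul_vecMulVec, matW_mulVec_nu h₁ h₂ hdisj,
    Matrix.zero_vecMulVec, smul_zero]

theorem matB_mul_matW (h₁ : C₁.Nonempty) (h₂ : C₂.Nonempty)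
    (hdisj : Disjoint C₁ C₂) : matB C₁ C₂ * matW C₁ C₂ = 0 := by
  have := congrArg Matrix.transpose (matW_mul_matB h₁ h₂ hdisj)
  rwa [Matrix.transpose_mul, isSymm_matW, isSymm_matB, Matrix.transpose_zero] at this

theorem trace_matB (h₁ : C₁.Nonempty) (h₂ : C₂.Nonempty)
    (hdisj : Disjoint C₁ C₂) : (matB C₁ C₂).trace = 1 := by
  have hs := (sum_nu_sq_pos h₁ h₂ hdisj).ne'
  have hd : nu C₁ C₂ ⬝ᵥ nu C₁ C₂ = ∑ i, nu C₁ C₂ i ^ 2 := by simp [dotProduct, sq]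
  rw [matB, Matrix.trace_smul, Matrix.trace_vecMulVec, hd, smul_eq_mul, inv_mul_cancel₀ hs]

theorem trace_matW (h₁ : C₁.Nonempty) (h₂ : C₂.Nonempty) :
    (matW C₁ C₂).trace = pairSize C₁ C₂ - 2 := by
  rw [matW, Matrix.trace_add, trace_centering h₁, trace_centering h₂, pairSize]
  ring

end Projections

end RandClust

/-! ### The test statistic and the auxiliary statistics -/

namespace RandClust

section Statistics

variable {n p : ℕ} {C₁ C₂ : Cluster n}

theorem sum_ind_smul (C : Cluster n) (x : Data n p) : ∑ k, ind C k • x k = ∑ k ∈ C, x k := by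
  simp [ind, ite_smul]

theorem sum_nu_smul (C₁ C₂ : Cluster n) (x : Data n p) :
    ∑ k, nu C₁ C₂ k • x k = clusterMean x C₁ - clusterMean x C₂ := by
  rw [nu_eq, clusterMean, clusterMean, ← sum_ind_smul C₁, ← sum_ind_smul C₂, Finset.smul_sum,
    Finset.smul_sum, ← Finset.sum_sub_distrib]
  refine Finset.sum_congr rfl fun k _ => ?_
  simp [sub_smul, mul_smul]

theorem matAct_matB (C₁ C₂ : Cluster n) (x : Data n p) (i : Fin n) :
    matAct (matB C₁ C₂) x i =
      ((∑ i, nu C₁ C₂ i ^ 2)⁻¹ * nu C₁ C₂ i) • (clusterMean x C₁ - clusterMean x C₂) := by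
  rw [← sum_nu_smul, Finset.smul_sum, matAct_apply]
  refine Finset.sum_congr rfl fun k _ => ?_
  rw [matB, Matrix.smul_apply, Matrix.vecMulVec_apply, smul_smul, smul_eq_mul, mul_assoc]

theorem matAct_centering (C : Cluster n) (x : Data n p) (i : Fin n) :
    matAct (centering C) x i = ind C i • (x i - clusterMean x C) := by
  rw [clusterMean, ← sum_ind_smul, smul_sub, Finset.smul_sum, Finset.smul_sum, matAct_apply]
  have h : ∀ k, centering C i k • x k =
      (if i = k then ind C i • x i else 0) - ind C i • (C.card : ℝ)⁻¹ • ind C k • x k := by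
    intro k
    rw [centering, Matrix.sub_apply, Matrix.smul_apply, Matrix.vecMulVec_apply,
      Matrix.diagonal_apply, sub_smul, smul_smul, smul_smul, smul_eq_mul]
    congr 1
    · split_ifs with hik
      · rw [hik]
      · rw [zero_smul]
    · congr 1
      ring
  rw [Finset.sum_congr rfl fun k _ => h k, Finset.sum_sub_distrib]
  simp

theorem frob_matB_sq (h₁ : C₁.Nonempty) (h₂ : C₂.Nonempty) (hdisj : Disjoint C₁ C₂)
    (x : Data n p) : frob (matAct (matB C₁ C₂) x) ^ 2 = bcss C₁ C₂ x := by
  have hs := (sum_nu_sq_pos h₁ h₂ hdisj).ne'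
  have hc₁ : (C₁.card : ℝ) ≠ 0 := by exact_mod_cast h₁.card_pos.ne'
  have hc₂ : (C₂.card : ℝ) ≠ 0 := by exact_mod_cast h₂.card_pos.ne'
  have h : ∀ i, ‖matAct (matB C₁ C₂) x i‖ ^ 2 = nu C₁ C₂ i ^ 2 *
      (((∑ i, nu C₁ C₂ i ^ 2)⁻¹) ^ 2 * ‖clusterMean x C₁ - clusterMean x C₂‖ ^ 2) := by
    intro i
    rw [matAct_matB, norm_smul, mul_pow, Real.norm_eq_abs, sq_abs, mul_pow]
    ring
  rw [frob_sq, Finset.sum_congr rfl fun i _ => h i, ← Finset.sum_mul, bcss, ← mul_assoc]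
  congr 1
  rw [inv_pow, sq, mul_inv, ← mul_assoc, mul_inv_cancel₀ hs, one_mul, sum_nu_sq h₁ h₂ hdisj,
    pairSize]
  field_simp
  ring

theorem frob_matW_sq (hdisj : Disjoint C₁ C₂) (x : Data n p) :
    frob (matAct (matW C₁ C₂) x) ^ 2 = wcss C₁ C₂ x := by
  have h : ∀ i, ‖matAct (matW C₁ C₂) x i‖ ^ 2 =
      (if i ∈ C₁ then ‖x i - clusterMean x C₁‖ ^ 2 else 0) +
        (if i ∈ C₂ then ‖x i - clusterMean x C₂‖ ^ 2 else 0) := by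
    intro i
    rw [matW, matAct_add_left, Pi.add_apply, matAct_centering, matAct_centering]
    by_cases hi : i ∈ C₁
    · simp [ind, hi, Finset.disjoint_left.1 hdisj hi]
    · simp only [ind, hi, if_false, zero_smul, zero_add]
      split_ifs <;> simp
  rw [frob_sq, Finset.sum_congr rfl fun i _ => h i, Finset.sum_add_distrib, wcss]
  simp

theorem testStat_eq (h₁ : C₁.Nonempty) (h₂ : C₂.Nonempty) (hdisj : Disjoint C₁ C₂)
    (x : Data n p) : testStat C₁ C₂ x = (pairSize C₁ C₂ - 2) *
      (frob (matAct (matB C₁ C₂) x) ^ 2 / frob (matAct (matW C₁ C₂) x) ^ 2) := by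
  rw [testStat, frob_matB_sq h₁ h₂ hdisj, frob_matW_sq hdisj]

theorem clusterMean_eq {C : Cluster n} (h : C.Nonempty) {μ : Data n p}
    {c : EuclideanSpace ℝ (Fin p)}
    (hμ : ∀ i ∈ C, μ i = c) : clusterMean μ C = c := by
  have hc : (C.card : ℝ) ≠ 0 := by exact_mod_cast h.card_pos.ne'
  rw [clusterMean, Finset.sum_congr rfl hμ, Finset.sum_const, ← Nat.cast_smul_eq_nsmul ℝ, smul_smul,
    inv_mul_cancel₀ hc, one_smul]

/-- Under the null hypothesis both projections annihilate the mean matrix. -/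
theorem matAct_of_null (h₁ : C₁.Nonempty) (h₂ : C₂.Nonempty) {μ : Data n p}
    (hnull : ∀ i ∈ C₁ ∪ C₂, ∀ i' ∈ C₁ ∪ C₂, μ i = μ i') :
    matAct (matB C₁ C₂) μ = 0 ∧ matAct (matW C₁ C₂) μ = 0 := by
  obtain ⟨j, hj⟩ := h₁
  have hj' : j ∈ C₁ ∪ C₂ := Finset.mem_union_left _ hj
  have e₁ : ∀ i ∈ C₁, μ i = μ j := fun i hi => hnull i (Finset.mem_union_left _ hi) j hj'
  have e₂ : ∀ i ∈ C₂, μ i = μ j := fun i hi => hnull i (Finset.mem_union_right _ hi) j hj'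
  constructor
  · funext i
    rw [matAct_matB, clusterMean_eq ⟨j, hj⟩ e₁, clusterMean_eq h₂ e₂, sub_self, smul_zero]
    rfl
  · funext i
    rw [matW, matAct_add_left, Pi.add_apply, matAct_centering, matAct_centering,
      clusterMean_eq ⟨j, hj⟩ e₁, clusterMean_eq h₂ e₂, ind, ind]
    have ha : (if i ∈ C₁ then (1 : ℝ) else 0) • (μ i - μ j) = 0 := by
      split_ifs with hi
      · rw [e₁ i hi, sub_self, smul_zero]
      · rw [zero_smul]
    have hb : (if i ∈ C₂ then (1 : ℝ) else 0) • (μ i - μ j) = 0 := by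
      split_ifs with hi
      · rw [e₂ i hi, sub_self, smul_zero]
      · rw [zero_smul]
    rw [ha, hb, add_zero]
    rfl

theorem pairSize_sub_two_pos (hN : 3 ≤ C₁.card + C₂.card) : 0 < pairSize C₁ C₂ - 2 := by
  have : (3 : ℝ) ≤ (C₁.card : ℝ) + C₂.card := by exact_mod_cast hN
  rw [pairSize]
  linarith

/-- The data are recovered from the test statistic and the auxiliary statistics. A positive test
statistic excludes the division by zero that occurs when the within-cluster part vanishes. -/
theorem reconstruct_testStat (h₁ : C₁.Nonempty) (h₂ : C₂.Nonempty) (hdisj : Disjoint C₁ C₂)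
    (hN : 3 ≤ C₁.card + C₂.card) {x : Data n p} (hx : testStat C₁ C₂ x ≠ 0) :
    reconstruct C₁ C₂ (testStat C₁ C₂ x) (auxStat C₁ C₂ x) = x := by
  have hk := pairSize_sub_two_pos hN
  rw [testStat_eq h₁ h₂ hdisj] at hx ⊢
  simp only [reconstruct, auxStat]
  have hβ := frob_nonneg (matAct (matB C₁ C₂) x)
  have hω := frob_nonneg (matAct (matW C₁ C₂) x)
  have hB := frob_smul_dir (matAct (matB C₁ C₂) x)
  have hW := frob_smul_dir (matAct (matW C₁ C₂) x)
  set β := frob (matAct (matB C₁ C₂) x)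
  set ω := frob (matAct (matW C₁ C₂) x)
  set k := pairSize C₁ C₂ - 2
  have hω0 : ω ≠ 0 := by
    rintro h
    simp [h] at hx
  have hωpos : 0 < ω := lt_of_le_of_ne hω hω0.symm
  have hΔ : 0 < β ^ 2 + ω ^ 2 := by positivity
  have e : k + k * (β ^ 2 / ω ^ 2) = k * (β ^ 2 + ω ^ 2) / ω ^ 2 := by field_simp; ring
  have e₁ : Real.sqrt (β ^ 2 + ω ^ 2) *
      Real.sqrt (k * (β ^ 2 / ω ^ 2) / (k + k * (β ^ 2 / ω ^ 2))) = β := by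
    rw [e, ← Real.sqrt_mul hΔ.le]
    have : (β ^ 2 + ω ^ 2) * (k * (β ^ 2 / ω ^ 2) / (k * (β ^ 2 + ω ^ 2) / ω ^ 2)) = β ^ 2 := by
      field_simp
    rw [this, Real.sqrt_sq hβ]
  have e₂ : Real.sqrt (β ^ 2 + ω ^ 2) * Real.sqrt (k / (k + k * (β ^ 2 / ω ^ 2))) = ω := by
    rw [e, ← Real.sqrt_mul hΔ.le]
    have : (β ^ 2 + ω ^ 2) * (k / (k * (β ^ 2 + ω ^ 2) / ω ^ 2)) = ω ^ 2 := by
      field_simp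
    rw [this, Real.sqrt_sq hω]
  rw [smul_add, smul_smul, smul_smul, e₁, e₂, hB, hW, matAct_sub_left, matAct_sub_left, matAct_one]
  abel

@[fun_prop]
theorem continuous_matAct (A : Matrix (Fin n) (Fin n) ℝ) :
    Continuous (matAct A : Data n p → Data n p) := by
  unfold matAct; fun_prop

@[fun_prop]
theorem continuous_frob : Continuous (frob : Data n p → ℝ) := by
  unfold frob; fun_prop

theorem measurable_dir : Measurable (dir : Data n p → Data n p) := by
  unfold dir
  have := (continuous_frob (n := n) (p := p)).measurable
  fun_prop

theorem measurable_testStat (h₁ : C₁.Nonempty) (h₂ : C₂.Nonempty) (hdisj : Disjoint C₁ C₂) :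
    Measurable (testStat C₁ C₂ : Data n p → ℝ) := by
  have : (testStat C₁ C₂ : Data n p → ℝ) = _ := funext (testStat_eq h₁ h₂ hdisj)
  rw [this]
  have h : ∀ A : Matrix (Fin n) (Fin n) ℝ, Measurable fun x : Data n p => frob (matAct A x) :=
    fun A => (continuous_frob.comp (continuous_matAct A)).measurable
  exact (((h _).pow_const 2).div ((h _).pow_const 2)).const_mul _

theorem measurable_auxStat (C₁ C₂ : Cluster n) :
    Measurable (auxStat C₁ C₂ : Data n p → Aux n p) := by
  have ha : ∀ A : Matrix (Fin n) (Fin n) ℝ, Measurable fun x : Data n p => matAct A x :=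
    fun A => (continuous_matAct A).measurable
  have h : ∀ A : Matrix (Fin n) (Fin n) ℝ, Measurable fun x : Data n p => frob (matAct A x) :=
    fun A => (continuous_frob.comp (continuous_matAct A)).measurable
  exact (measurable_dir.comp (ha _)).prodMk ((measurable_dir.comp (ha _)).prodMk
    ((((h _).pow_const 2).add ((h _).pow_const 2)).prodMk (ha _)))

theorem measurable_reconstruct (C₁ C₂ : Cluster n) :
    Measurable fun z : Aux n p × ℝ => reconstruct C₁ C₂ z.2 z.1 := by
  unfold reconstruct
  fun_prop

/-- The law of the ratio of two independent `χ²` variables has the `F` density, up to a constant.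
The constant cancels in the ratio of integrals that defines the selective distribution function. -/
theorem exists_pos_fDensity_eq_ratioKernel {q k : ℝ} (hq : 0 < q) (hk : 0 < k) :
    ∃ c : ℝ, 0 < c ∧ ∀ r ∈ Set.Ioi (0 : ℝ),
      ratioKernel (q / 2) (k * q / 2) k r = c * fDensity q (k * q) r := by
  have hkq : 0 < k * q := by positivity
  set G := Real.Gamma ((q + k * q) / 2) / (Real.Gamma (q / 2) * Real.Gamma (k * q / 2)) *
    (q / (k * q)) ^ (q / 2)
  have hG : 0 < G := by
    have h1 := Real.Gamma_pos_of_pos (show 0 < (q + k * q) / 2 by positivity)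
    have h2 := Real.Gamma_pos_of_pos (show 0 < q / 2 by positivity)
    have h3 := Real.Gamma_pos_of_pos (show 0 < k * q / 2 by positivity)
    have h4 : 0 < (q / (k * q)) ^ (q / 2) := by positivity
    positivity
  refine ⟨k ^ (k * q / 2) * k ^ (-((q + k * q) / 2)) / G, by positivity, fun r hr => ?_⟩
  have hr : 0 < r := hr
  have e : k + r = k * (1 + q / (k * q) * r) := by field_simp
  have e' : q / 2 + k * q / 2 = (q + k * q) / 2 := by ring
  rw [ratioKernel, fDensity, e, Real.mul_rpow hk.le (by positivity), e']
  change _ = _ * (G * _ * _)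
  field_simp

end Statistics

end RandClust

/-! ### The joint law of the test statistic and the auxiliary statistics -/

namespace RandClust

section Law

variable {n p : ℕ} {C₁ C₂ : Cluster n}

theorem frob_smul_of_frob_eq_one {c : ℝ} (hc : 0 < c) {x : Data n p} (hx : frob x = 1) :
    frob (c • x) = c := by
  rw [frob_eq_norm] at hx ⊢
  rw [WithLp.toLp_smul, norm_smul, hx, mul_one, Real.norm_of_nonneg hc.le]

theorem dir_smul_of_frob_eq_one {c : ℝ} (hc : 0 < c) {x : Data n p} (hx : frob x = 1) :
    dir (c • x) = x := by
  rw [dir, frob_smul_of_frob_eq_one hc hx, smul_smul, inv_mul_cancel₀ hc.ne', one_smul]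

/-- The statistics of a data matrix whose between-cluster and within-cluster parts have squared
Frobenius norms `σ² s r / (k + r)` and `σ² s k / (k + r)`, with `k = N - 2`. -/
theorem stat_eq_of_polar (h₁ : C₁.Nonempty) (h₂ : C₂.Nonempty) (hdisj : Disjoint C₁ C₂)
    (hN : 3 ≤ C₁.card + C₂.card) {σ r s : ℝ} (hσ : 0 < σ) (hr : 0 < r) (hs : 0 < s)
    {x θ φ : Data n p} (hθ : frob θ = 1) (hφ : frob φ = 1)
    (hB : matAct (matB C₁ C₂) x = (σ * Real.sqrt (s * r / (pairSize C₁ C₂ - 2 + r))) • θ)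
    (hW : matAct (matW C₁ C₂) x =
      (σ * Real.sqrt (s * (pairSize C₁ C₂ - 2) / (pairSize C₁ C₂ - 2 + r))) • φ) :
    testStat C₁ C₂ x = r ∧
      auxStat C₁ C₂ x = (θ, φ, σ ^ 2 * s, matAct (1 - matB C₁ C₂ - matW C₁ C₂) x) := by
  have hk := pairSize_sub_two_pos hN
  rw [testStat_eq h₁ h₂ hdisj, auxStat, hB, hW]
  set k := pairSize C₁ C₂ - 2
  have hkr : 0 < k + r := by positivity
  have p₁ : 0 < σ * Real.sqrt (s * r / (k + r)) := by positivity
  have p₂ : 0 < σ * Real.sqrt (s * k / (k + r)) := by positivity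
  rw [dir_smul_of_frob_eq_one p₁ hθ, dir_smul_of_frob_eq_one p₂ hφ,
    frob_smul_of_frob_eq_one p₁ hθ, frob_smul_of_frob_eq_one p₂ hφ, mul_pow, mul_pow,
    Real.sq_sqrt (by positivity), Real.sq_sqrt (by positivity)]
  refine ⟨by field_simp, ?_⟩
  have : σ ^ 2 * (s * r / (k + r)) + σ ^ 2 * (s * k / (k + r)) = σ ^ 2 * s := by
    field_simp
    ring
  rw [this]

/-- A coordinate that splits off almost everywhere under a product law yields a product law. -/
theorem map_prod_map_eq_prod {Y T Z 𝒜 : Type*} [MeasurableSpace Y] [MeasurableSpace T]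
    [MeasurableSpace Z] [MeasurableSpace 𝒜] {γ : Measure Y} {S : Measure T} {l : Measure ℝ}
    [SFinite γ] [SFinite S] [SFinite l] {Ψ : T × ℝ → Z} (hΨ : Measurable Ψ) {f : Y × Z → 𝒜 × ℝ}
    (hf : Measurable f) {a : Y × T → 𝒜} (ha : Measurable a)
    (hae : ∀ᵐ z ∂((γ.prod S).prod l), f (z.1.1, Ψ (z.1.2, z.2)) = (a z.1, z.2)) :
    (γ.prod ((S.prod l).map Ψ)).map f = ((γ.prod S).map a).prod l := by
  have hprod := Measure.map_prod_map γ (S.prod l) measurable_id hΨ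
  have hΘ := (measurable_id : Measurable (id : Y → Y)).prodMap hΨ
  rw [Measure.map_id, ← Measure.prodAssoc_prod] at hprod
  rw [hprod, Measure.map_map hf hΘ, Measure.map_map (hf.comp hΘ)
    MeasurableEquiv.prodAssoc.measurable]
  conv_rhs => rw [← Measure.map_id (μ := l)]
  rw [Measure.map_prod_map _ _ ha measurable_id]
  exact Measure.map_congr hae

/-- A statistic of a standard Gaussian vector whose first component depends only on the directions
of the projections `b x` and `w x`, on the sum of their squared norms and on the complementary
projection `g x`, and whose second component is `k ‖b x‖² / ‖w x‖²`, has a product law. -/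
theorem exists_map_stdGaussian_eq_prod {H 𝒜 : Type*} [NormedAddCommGroup H]
    [InnerProductSpace ℝ H] [FiniteDimensional ℝ H] [MeasurableSpace H] [BorelSpace H]
    [MeasurableSpace 𝒜] {b w g : H →ₗ[ℝ] H} (hb : b.IsSymmetric) (hw : w.IsSymmetric)
    (hg : g.IsSymmetric) (hbb : ∀ x, b (b x) = b x) (hww : ∀ x, w (w x) = w x)
    (hgg : ∀ x, g (g x) = g x) (hsum : ∀ x, b x + w x + g x = x)
    [Nontrivial (LinearMap.range b)] [Nontrivial (LinearMap.range w)] {k : ℝ} (hk : 0 < k)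
    {f : H → 𝒜 × ℝ} (hf : Measurable f) {a : H × H × ℝ × H → 𝒜} (ha : Measurable a)
    (hfa : ∀ θ φ y : H, b θ = θ → w φ = φ → g y = y → ‖θ‖ = 1 → ‖φ‖ = 1 → ∀ r s : ℝ, 0 < r → 0 < s →
      f (y + (Real.sqrt (s * r / (k + r)) • θ + Real.sqrt (s * k / (k + r)) • φ)) =
        (a (θ, φ, s, y), r)) :
    ∃ Q : Measure 𝒜, SFinite Q ∧ (stdGaussian H).map f = Q.prod (halfLineMeasure
      (ratioKernel (Module.finrank ℝ (LinearMap.range b) / 2)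
        (Module.finrank ℝ (LinearMap.range w) / 2) k)) := by
  obtain ⟨ς, _, h, hpolar⟩ := exists_prod_stdGaussian_eq_map (LinearMap.range b)
    (LinearMap.range w) hk
  rw [stdGaussian_eq_map_add hb hw hg hbb hww hgg hsum, hpolar]
  have hadd : Measurable fun z : LinearMap.range g × LinearMap.range b × LinearMap.range w =>
      (z.1 : H) + (z.2.1 + z.2.2) := by fun_prop
  have hΨ : Measurable fun z : ((Metric.sphere (0 : LinearMap.range b) 1 ×
      Metric.sphere (0 : LinearMap.range w) 1) × ℝ) × ℝ =>
      (Real.sqrt (z.1.2 * z.2 / (k + z.2)) • (z.1.1.1 : LinearMap.range b),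
        Real.sqrt (z.1.2 * k / (k + z.2)) • (z.1.1.2 : LinearMap.range w)) := by
    fun_prop
  have hcoord : Measurable fun z : LinearMap.range g × ((Metric.sphere (0 : LinearMap.range b) 1 ×
      Metric.sphere (0 : LinearMap.range w) 1) × ℝ) =>
      (((z.2.1.1 : LinearMap.range b) : H), ((z.2.1.2 : LinearMap.range w) : H), z.2.2,
        (z.1 : H)) := by
    fun_prop
  set γ := stdGaussian (LinearMap.range g)
  refine ⟨_, inferInstance, (Measure.map_map hf hadd).trans
    (map_prod_map_eq_prod hΨ (hf.comp hadd) (ha.comp hcoord) ?_)⟩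
  have hpos : ∀ f : ℝ → ℝ, ∀ᵐ r ∂(halfLineMeasure f), 0 < r := fun f =>
    (withDensity_absolutelyContinuous _ _).ae_le (ae_restrict_mem measurableSet_Ioi)
  have hs : ∀ᵐ z ∂(γ.prod (ς.prod (halfLineMeasure h))), 0 < z.2.2 :=
    Measure.quasiMeasurePreserving_snd.ae (Measure.quasiMeasurePreserving_snd.ae (hpos _))
  filter_upwards [Measure.quasiMeasurePreserving_snd.ae (hpos _),
    Measure.quasiMeasurePreserving_fst.ae hs] with z hzr hzs
  have hfix : ∀ {e : H →ₗ[ℝ] H}, (∀ x, e (e x) = e x) → ∀ y : LinearMap.range e, e y = y := by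
    rintro e he ⟨_, x, rfl⟩
    exact he x
  exact hfa _ _ _ (hfix hbb _) (hfix hww _) (hfix hgg _) (norm_eq_of_mem_sphere z.1.2.1.1)
    (norm_eq_of_mem_sphere z.1.2.1.2) z.2 z.1.2.2 hzr hzs

/-- Under the null hypothesis the test statistic is independent of the auxiliary statistics, and it
follows an `F` distribution. -/
theorem exists_map_gaussianData_eq_prod (hp : 1 ≤ p) (h₁ : C₁.Nonempty) (h₂ : C₂.Nonempty)
    (hdisj : Disjoint C₁ C₂) (hN : 3 ≤ C₁.card + C₂.card) {σ : ℝ} (hσ : 0 < σ) {μ : Data n p}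
    (hnull : ∀ i ∈ C₁ ∪ C₂, ∀ i' ∈ C₁ ∪ C₂, μ i = μ i') :
    ∃ Q : Measure (Aux n p), SFinite Q ∧
      (gaussianData μ σ).map (fun x => (auxStat C₁ C₂ x, testStat C₁ C₂ x)) =
        Q.prod (halfLineMeasure (ratioKernel (p / 2) ((pairSize C₁ C₂ - 2) * p / 2)
          (pairSize C₁ C₂ - 2))) := by
  obtain ⟨hBμ, hWμ⟩ := matAct_of_null h₁ h₂ hnull
  have hk := pairSize_sub_two_pos hN
  have hp' : (0 : ℝ) < p := by exact_mod_cast hp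
  have hBB := matB_mul_self h₁ h₂ hdisj
  have hWW := matW_mul_self h₁ h₂ hdisj
  have hBW := matB_mul_matW h₁ h₂ hdisj
  have hWB := matW_mul_matB h₁ h₂ hdisj
  have hBsymm := isSymm_matB C₁ C₂
  have hWsymm := isSymm_matW C₁ C₂
  have hBtr := trace_matB h₁ h₂ hdisj
  have hWtr := trace_matW h₁ h₂
  have hψ : Measurable fun x : DataSpace n p => (auxStat C₁ C₂ x.ofLp, testStat C₁ C₂ x.ofLp) :=
    ((measurable_auxStat C₁ C₂).prodMk (measurable_testStat h₁ h₂ hdisj)).comp (by fun_prop)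
  set B := matB C₁ C₂
  set W := matW C₁ C₂
  set G := 1 - B - W with hG
  set k := pairSize C₁ C₂ - 2
  have hBG : B * G = 0 := by rw [hG, mul_sub, mul_sub, hBB, hBW, mul_one, sub_self, sub_zero]
  have hWG : W * G = 0 := by rw [hG, mul_sub, mul_sub, hWW, hWB, mul_one, sub_zero, sub_self]
  have hGB : G * B = 0 := by rw [hG, sub_mul, sub_mul, hBB, hWB, one_mul, sub_self, sub_zero]
  have hGW : G * W = 0 := by rw [hG, sub_mul, sub_mul, hWW, hBW, one_mul, sub_zero, sub_self]
  have hGG : G * G = G := by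
    conv_lhs => rw [hG, sub_mul, sub_mul, one_mul, hBG, hWG, sub_zero, sub_zero]
  have hGsymm : G.IsSymm := (Matrix.isSymm_one.sub hBsymm).sub hWsymm
  have hid : ∀ {A : Matrix (Fin n) (Fin n) ℝ}, A * A = A →
      ∀ x : DataSpace n p, matLin p A (matLin p A x) = matLin p A x := fun h x => by
    rw [matLin_matLin, h]
  have hkill : ∀ {A A' : Matrix (Fin n) (Fin n) ℝ}, A * A' = 0 →
      ∀ {y : DataSpace n p}, matLin p A' y = y → matLin p A y = 0 := by
    intro A A' h y hy
    rw [← hy, matLin_matLin, h, matLin_apply, matAct_zero_left]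
    rfl
  have hsum : ∀ x : DataSpace n p, matLin p B x + matLin p W x + matLin p G x = x := by
    intro x
    simp only [matLin_apply, ← WithLp.toLp_add, ← matAct_add_left]
    rw [hG, show B + W + (1 - B - W) = 1 by abel, matAct_one]
  have hrankB : (Module.finrank ℝ (LinearMap.range (matLin p B)) : ℝ) = p := by
    rw [finrank_range_matLin hBB, hBtr, mul_one]
  have hrankW : (Module.finrank ℝ (LinearMap.range (matLin p W)) : ℝ) = k * p := by
    rw [finrank_range_matLin hWW, hWtr, mul_comm]
  have : Nontrivial (LinearMap.range (matLin p B)) := by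
    refine Module.nontrivial_of_finrank_pos (R := ℝ) ?_
    rw [← Nat.cast_pos (α := ℝ), hrankB]
    exact hp'
  have : Nontrivial (LinearMap.range (matLin p W)) := by
    refine Module.nontrivial_of_finrank_pos (R := ℝ) ?_
    rw [← Nat.cast_pos (α := ℝ), hrankW]
    positivity
  have haff : Measurable fun x : DataSpace n p => WithLp.toLp 2 μ + σ • x := by fun_prop
  -- The auxiliary statistics as a function of the polar coordinates `(θ, φ, s)` and of the
  -- complementary projection.
  have ha : Measurable fun z : DataSpace n p × DataSpace n p × ℝ × DataSpace n p =>
      (z.1.ofLp, z.2.1.ofLp, σ ^ 2 * z.2.2.1, matAct G μ + σ • z.2.2.2.ofLp) :=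
    Measurable.prodMk (by fun_prop) (Measurable.prodMk (by fun_prop)
      (Measurable.prodMk (by fun_prop) (by fun_prop)))
  have hpair : (fun x : Data n p => (auxStat C₁ C₂ x, testStat C₁ C₂ x)) =
      (fun x : DataSpace n p => (auxStat C₁ C₂ x.ofLp, testStat C₁ C₂ x.ofLp)) ∘
        WithLp.toLp 2 := rfl
  rw [hpair, ← Measure.map_map hψ (by fun_prop), map_toLp_gaussianData,
    Measure.map_map hψ haff, ← hrankW, ← hrankB]
  refine exists_map_stdGaussian_eq_prod (isSymmetric_matLin hBsymm) (isSymmetric_matLin hWsymm)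
    (isSymmetric_matLin hGsymm) (hid hBB) (hid hWW) (hid hGG) hsum hk (hψ.comp haff) ha ?_
  intro θ φ y hθ hφ hy hθ1 hφ1 r s hr hs
  set x : DataSpace n p := WithLp.toLp 2 μ + σ • (y + (Real.sqrt (s * r / (k + r)) • θ +
    Real.sqrt (s * k / (k + r)) • φ)) with hx
  have hpart : ∀ A : Matrix (Fin n) (Fin n) ℝ, matLin p A x = WithLp.toLp 2 (matAct A μ) +
      σ • (matLin p A y + (Real.sqrt (s * r / (k + r)) • matLin p A θ +
        Real.sqrt (s * k / (k + r)) • matLin p A φ)) := by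
    intro A
    rw [hx, map_add, map_smul, map_add, map_add, map_smul, map_smul]
    rfl
  have hBx : matAct B x.ofLp = (σ * Real.sqrt (s * r / (k + r))) • θ.ofLp := by
    have e := hpart B
    rw [hkill hBG hy, hθ, hkill hBW hφ, hBμ, smul_zero, add_zero, zero_add, WithLp.toLp_zero,
      zero_add, smul_smul] at e
    exact congrArg WithLp.ofLp e
  have hWx : matAct W x.ofLp = (σ * Real.sqrt (s * k / (k + r))) • φ.ofLp := by
    have e := hpart W
    rw [hkill hWG hy, hφ, hkill hWB hθ, hWμ, smul_zero, zero_add, zero_add, WithLp.toLp_zero,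
      zero_add, smul_smul] at e
    exact congrArg WithLp.ofLp e
  have hGx : matAct G x.ofLp = matAct G μ + σ • y.ofLp := by
    have e := hpart G
    rw [hkill hGB hθ, hkill hGW hφ, hy, smul_zero, smul_zero, add_zero, add_zero] at e
    exact congrArg WithLp.ofLp e
  obtain ⟨e₁, e₂⟩ := stat_eq_of_polar h₁ h₂ hdisj hN hσ hr hs ((frob_eq_norm _).trans hθ1)
    ((frob_eq_norm _).trans hφ1) hBx hWx
  exact Prod.ext (e₂.trans (congrArg (fun z => (θ.ofLp, φ.ofLp, σ ^ 2 * s, z)) hGx)) e₁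

end Law

end RandClust

open RandClust

theorem theorem2 {Ω : Type*} [MeasurableSpace Ω] (P : Measure Ω) [IsProbabilityMeasure P]
    (n p K : ℕ) (hp : 1 ≤ p) (hK : 1 ≤ K)
    (d : RandClust.Merge n → RandClust.Data n p → ℝ) (hd : ∀ c, Measurable (d c))
    (τ : ℝ) (hτ : 0 < τ)
    (μ : RandClust.Data n p) (σ : ℝ) (hσ : 0 < σ)
    (X : Ω → RandClust.Data n p) (hX : Measurable X)
    (hlaw : HasLaw X (RandClust.gaussianData μ σ) P)
    (M : ℕ → Ω → RandClust.Merge n)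
    (hM : RandClust.IsRandomizedClustering P d τ K X M)
    (t : ℕ) (ht : 1 ≤ t) (htK : t ≤ n - K)
    (m : ℕ → RandClust.Merge n)
    (hpos : P (RandClust.mergeEvent M m t) ≠ 0)
    (C₁ C₂ : RandClust.Cluster n) (hm : m (t - 1) = s(C₁, C₂))
    (hN : 3 ≤ C₁.card + C₂.card)
    (hnull : ∀ i ∈ C₁ ∪ C₂, ∀ i' ∈ C₁ ∪ C₂, μ i = μ i') :
    (∀ᵐ ω ∂(P[|RandClust.mergeEvent M m t]),
      RandClust.condPValue P X (RandClust.mergeEvent M m t) C₁ C₂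
          (RandClust.testStat C₁ C₂ (X ω)) (RandClust.auxStat C₁ C₂ (X ω)) =
        1 - RandClust.selCDF d τ m t C₁ C₂
          (RandClust.testStat C₁ C₂ (X ω)) (RandClust.auxStat C₁ C₂ (X ω))) ∧
    ∀ α : ℝ, 0 ≤ α → α ≤ 1 →
      P[|RandClust.mergeEvent M m t]
        {ω | RandClust.condPValue P X (RandClust.mergeEvent M m t) C₁ C₂
          (RandClust.testStat C₁ C₂ (X ω)) (RandClust.auxStat C₁ C₂ (X ω)) ≤ α} =
        ENNReal.ofReal α := by
  have hcand := hM.mem_candidates hX hd htK hpos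
  obtain ⟨h₁, h₂, hdisj⟩ := nonempty_disjoint_of_mem_candidates (t := t - 1)
    (fun s hs => hcand s (by omega)) (hm ▸ hcand (t - 1) (by omega))
  obtain ⟨Q, _, hQ⟩ := exists_map_gaussianData_eq_prod hp h₁ h₂ hdisj hN hσ hnull
  have hk := pairSize_sub_two_pos hN
  have hp' : (0 : ℝ) < p := by exact_mod_cast hp
  have hRm := measurable_testStat (p := p) h₁ h₂ hdisj
  have hAm := measurable_auxStat (p := p) C₁ C₂
  have hR : Measurable fun ω => testStat C₁ C₂ (X ω) := hRm.comp hX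
  have hA : Measurable fun ω => auxStat C₁ C₂ (X ω) := hAm.comp hX
  obtain ⟨c, hc, hf⟩ := exists_pos_fDensity_eq_ratioKernel hp' hk
  set k := pairSize C₁ C₂ - 2 with hkdef
  set f := ratioKernel (p / 2) (k * p / 2) k with hfdef
  have hf0 : ∀ r ∈ Set.Ioi (0 : ℝ), 0 ≤ f r := by
    intro r hr
    have hr : 0 < r := hr
    rw [hfdef, ratioKernel]
    positivity
  have hlawAR : P.map (fun ω => (auxStat C₁ C₂ (X ω), testStat C₁ C₂ (X ω))) =
      Q.prod (halfLineMeasure f) := by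
    rw [← hQ, ← hlaw.map_eq, Measure.map_map (hAm.prodMk hRm) hX]
    rfl
  have hw : Measurable (Function.uncurry fun (a : Aux n p) (r : ℝ) =>
      pathProb d τ m t (reconstruct C₁ C₂ r a)) :=
    (measurable_pathProb hd τ m t).comp (measurable_reconstruct C₁ C₂)
  -- The test statistic is almost surely positive, so the data are recovered from `(A, R)`.
  have hRpos : ∀ᵐ ω ∂P, testStat C₁ C₂ (X ω) ≠ 0 := by
    have h : ∀ᵐ z ∂(Q.prod (halfLineMeasure f)), 0 < z.2 :=
      Measure.quasiMeasurePreserving_snd.ae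
        ((withDensity_absolutelyContinuous _ _).ae_le (ae_restrict_mem measurableSet_Ioi))
    rw [← hlawAR] at h
    filter_upwards [ae_of_ae_map (hA.prodMk hR).aemeasurable h] with ω hω
    exact ne_of_gt hω
  have hsel : ∀ S : Set (Aux n p × ℝ), MeasurableSet S →
      P (mergeEvent M m t ∩ (fun ω => (auxStat C₁ C₂ (X ω), testStat C₁ C₂ (X ω))) ⁻¹' S) =
        ∫⁻ ω in (fun ω => (auxStat C₁ C₂ (X ω), testStat C₁ C₂ (X ω))) ⁻¹' S,
          ENNReal.ofReal (pathProb d τ m t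
            (reconstruct C₁ C₂ (testStat C₁ C₂ (X ω)) (auxStat C₁ C₂ (X ω)))) ∂P := by
    intro S hS
    have hS' : MeasurableSet ((fun x => (auxStat C₁ C₂ x, testStat C₁ C₂ x)) ⁻¹' S) :=
      (hAm.prodMk hRm) hS
    have e := congrArg (fun ν => ν ((fun x => (auxStat C₁ C₂ x, testStat C₁ C₂ x)) ⁻¹' S))
      (hM.map_restrict_mergeEvent hX hd m htK)
    rw [Measure.map_apply hX hS', Measure.restrict_apply (hX hS'), withDensity_apply _ hS',
      setLIntegral_map hS' (measurable_pathProb hd τ m t).ennreal_ofReal hX] at e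
    rw [Set.inter_comm]
    refine e.trans (lintegral_congr_ae (ae_restrict_of_ae ?_))
    filter_upwards [hRpos] with ω hω
    rw [reconstruct_testStat h₁ h₂ hdisj hN hω]
  obtain ⟨hi, hii⟩ := selective_pValue (hM.measurableSet_mergeEvent hX m htK) hpos hR hA
    (measurable_ratioKernel _ _ _) hf0 hlawAR hw (fun a r => pathProb_pos hcand _)
    (fun a r => pathProb_le_one ..) hsel
  refine ⟨?_, hii⟩
  have hint : ∀ (a : Aux n p) (s : Set ℝ), MeasurableSet s → s ⊆ Set.Ioi 0 →
      ∫ r in s, f r * pathProb d τ m t (reconstruct C₁ C₂ r a) =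
        c * ∫ r in s, selDensity d τ m t C₁ C₂ a r := by
    intro a s hs hs0
    rw [← integral_const_mul]
    refine setIntegral_congr_fun hs fun r hr => ?_
    simp only [selDensity, ← hkdef]
    rw [hf r (hs0 hr), mul_assoc]
    rfl
  filter_upwards [hi] with ω hω
  refine hω.trans ?_
  rw [hint _ _ measurableSet_Ioc fun r hr => hr.1, hint _ _ measurableSet_Ioi subset_rfl, selCDF,
    mul_div_mul_left _ _ hc.ne']
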